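/- **Setting.** Let $\mathcal S,\mathcal A$ be measurable spaces, $\mu$ an s-finite reference measure on $\mathcal A$ (counting measure in the discrete case), $P(ds'\mid s,a)$ a Markov transition kernel, $c:\mathcal S\times\mathcal A\times\mathcal S\to\mathbb R$ a measurable cost, and $T\in\mathbb N$. Let $\Theta\subseteq\mathbb R^d$ be open and, for $\theta\in\Theta$, let $\pi^\theta(a\mid s)$ be a policy, i.e. a jointly measurable probability density in $a$ with respect to $\mu$, continuous in $\theta$. Write $\mathbb P^\theta(da,ds'\mid s)=\pi^\theta(a\mid s)\,\mu(da)\,P(ds'\mid s,a)$ for the joint law of the action $a_t$ and the next state $s_{t+1}$ given $s_t=s$, and $c_t=c(s_t,a_t,s_{t+1})$. The costs are integrable: $\mathbb E^\theta\big[\sum_{t<T}|c_t|\,\big|\,s_0=s\big]<\infty$ for all $s\in\mathcal S$ and $\theta\in\Theta$. Let $\varphi=\sum_{m=1}^{k}p_m\delta_{\alpha_m}$ with $p_m>0$, $\sum_m p_m=1$, $0<\alpha_1<\dots<\alpha_k<1$, and let $\mathrm{CVaR}_\alpha(X)=\frac1{1-\alpha}\int_\alpha^1\mathrm{VaR}_u(X)\,du$,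 where $\mathrm{VaR}_u$ is the (lower) $u$-quantile. The value function is defined by $V_T=0$ and $$V_t(s;\theta)=\sum_{m=1}^{k}p_m\,\mathrm{CVaR}_{\alpha_m}\big(X_t\big),\qquad X_t=X_t^{s,\theta}=c_t+V_{t+1}(s_{t+1};\theta),\quad (a_t,s_{t+1})\sim\mathbb P^\theta(\cdot,\cdot\mid s),\quad 0\le t<T.$$ For each $t,s,\theta,m$ consider the Lagrangian $L(\xi,\lambda)=\mathbb E[X_t\xi]-\lambda(\mathbb E[\xi]-1)$ under $\mathbb P^\theta(\cdot,\cdot\mid s)$, for measurable $\xi=\xi(a,s')$ with $0\le\xi\le\frac1{1-\alpha_m}$ a.s. and $\lambda\in\mathbb R$. A saddle-point $(\xi_m^*,\lambda_m^*)$ satisfies $L(\xi,\lambda_m^*)\le L(\xi_m^*,\lambda_m^*)\le L(\xi_m^*,\lambda)$ for all such $\xi,\lambda$. **Assumptions.** Suppose that $\theta\mapsto\log\pi^\theta(a\mid s)$ is differentiable at every $\theta\in\Theta$ where $\pi^\theta(a\mid s)\ne0$, and that its gradient is bounded there by a constant independent of $(\theta,s,a)$. Fix $\theta\in\Theta$ such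 that 1. for all $t<T$, $s$ and $m$, the $\alpha_m$-quantile of $X_t$ is unique; 2. for all $t<T-1$, $s$ and $m$, the measure $B\mapsto\mathbb E[\xi_m^*\mathbf 1_{\{s_{t+1}\in B\}}]$ on $\mathcal S$ is the same for all saddle-points $(\xi_m^*,\lambda_m^*)$. (Given 1, this is automatic if $X_t$ has no atom at its $\alpha_m$-quantile.) **Conclusion.** For every $s\in\mathcal S$ and $0\le t<T$, saddle-points exist for every $m$, the function $V_t(s;\cdot)$ is differentiable at $\theta$, and for every choice of saddle-points $(\xi_m^*,\lambda_m^*)_{m}$ the integrands below are integrable and $$\nabla_\theta V_{T-1}(s;\theta)=\sum_{m=1}^{k}\frac{p_m}{1-\alpha_m}\,\mathbb E_{\mathbb P^\theta(\cdot,\cdot\mid s)}\Big[(c_{T-1}-\lambda_m^*)_+\,\nabla_\theta\log\pi^\theta(a_{T-1}\mid s)\Big],$$ while for $t<T-1$ $$\nabla_\theta V_t(s;\theta)=\sum_{m=1}^{k}\Big(\frac{p_m}{1-\alpha_m}\,\mathbb E_{\mathbb P^\theta(\cdot,\cdot\mid s)}\Big[\big(c_t+V_{t+1}(s_{t+1};\theta)-\lambda_m^*\big)_+\nabla_\theta\log\pi^\theta(a_t\mid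 s)\Big]+p_m\,\mathbb E_{\mathbb P^\theta(\cdot,\cdot\mid s)}\Big[\nabla_\theta V_{t+1}(s';\theta)\big|_{s'=s_{t+1}}\;\xi_m^*(a_t,s_{t+1})\Big]\Big).$$ -/

import Mathlib

open MeasureTheory ProbabilityTheory Set

noncomputable section

/-- `x` is an `a`-quantile of the distribution `ν`: `ν(-∞, x) ≤ a ≤ ν(-∞, x]`. -/
def IsQuantile (ν : Measure ℝ) (a x : ℝ) : Prop :=
  ν.real (Iio x) ≤ a ∧ a ≤ ν.real (Iic x)

/-- Value-at-risk: the (lower) `u`-quantile of the distribution `ν`. -/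
def VaR (ν : Measure ℝ) (u : ℝ) : ℝ :=
  sInf {x : ℝ | u ≤ ν.real (Iic x)}

/-- Conditional value-at-risk with threshold `a` of the distribution `ν`. -/
def CVaR (ν : Measure ℝ) (a : ℝ) : ℝ :=
  (1 - a)⁻¹ * ∫ u in a..1, VaR ν u

section MDP

variable {S A : Type*} [MeasurableSpace S] [MeasurableSpace A]

/-- The joint law `ℙ^θ(da, ds' | s) = π(a | s) μ(da) P(ds' | s, a)` of action and next state,
for a policy with density `q` with respect to the reference measure `μ` on actions. -/
def stepLaw (μ : Measure A) [SFinite μ] (P : Kernel (S × A) S) (q : S → A → ℝ) :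
    Kernel S (A × S) :=
  (Kernel.withDensity (Kernel.const S μ) (fun s a => ENNReal.ofReal (q s a))) ⊗ₖ P

/-- The dynamic spectral risk over the next `n` periods, started in state `s`, when every one-step
conditional risk measure is `∑ m, p m * CVaR_{α m}` and `Q` is the one-step law. -/
def riskToGo {k : ℕ} (c : S → A → S → ℝ) (Q : Kernel S (A × S)) (α p : Fin k → ℝ) :
    ℕ → S → ℝ
  | 0, _ => 0
  | n + 1, s =>
    ∑ m, p m * CVaR ((Q s).map (fun y => c s y.1 y.2 + riskToGo c Q α p n y.2)) (α m)

/-- The value function `V_t(s)` of the `T`-period problem, for `t < T`; moreover `V_T = 0`. -/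
def valueFn {k : ℕ} (c : S → A → S → ℝ) (Q : Kernel S (A × S)) (α p : Fin k → ℝ)
    (T t : ℕ) (s : S) : ℝ :=
  riskToGo c Q α p (T - t) s

/-- The running risk-to-go `c(s, a, s') + V_{t+1}(s')`, as a function of `(a, s')`. -/
def runningCost {k : ℕ} (c : S → A → S → ℝ) (Q : Kernel S (A × S)) (α p : Fin k → ℝ)
    (T t : ℕ) (s : S) (y : A × S) : ℝ :=
  c s y.1 y.2 + valueFn c Q α p T (t + 1) y.2

/-- The expected total absolute cost over the next `n` periods, started in state `s`. -/
def expectedAbsCost (c : S → A → S → ℝ) (Q : Kernel S (A × S)) : ℕ → S → ENNReal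
  | 0, _ => 0
  | n + 1, s => ∫⁻ y, (‖c s y.1 y.2‖ₑ + expectedAbsCost c Q n y.2) ∂(Q s)

end MDP

section Lagrangian

variable {Y : Type*} [MeasurableSpace Y]

/-- The functions `ξ` with values in `[0, 1 / (1 - a)]`. -/
def BoxConstraint (ν : Measure Y) (a : ℝ) (ξ : Y → ℝ) : Prop :=
  Measurable ξ ∧ ∀ᵐ y ∂ν, 0 ≤ ξ y ∧ ξ y ≤ (1 - a)⁻¹

/-- The Lagrangian of the dual problem
`CVaR_a(X) = sup {E[X ξ] : E[ξ] = 1, 0 ≤ ξ ≤ 1 / (1 - a)}`. -/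
def lagrangian (ν : Measure Y) (X ξ : Y → ℝ) (l : ℝ) : ℝ :=
  (∫ y, X y * ξ y ∂ν) - l * ((∫ y, ξ y ∂ν) - 1)

/-- `(ξ, l)` is a saddle-point of the Lagrangian: `ξ` maximises over the box and `l` minimises
over the reals. -/
def IsSaddlePoint (ν : Measure Y) (X : Y → ℝ) (a : ℝ) (ξ : Y → ℝ) (l : ℝ) : Prop :=
  BoxConstraint ν a ξ ∧
    (∀ η : Y → ℝ, BoxConstraint ν a η → lagrangian ν X η l ≤ lagrangian ν X ξ l) ∧
    ∀ r : ℝ, lagrangian ν X ξ l ≤ lagrangian ν X ξ r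

end Lagrangian

end

/-! The proof is an envelope argument for CVaR, iterated backwards in time. Call a weight `ξ`
extremal at level `l` if it lies in `[0, 1/(1-a)]`, has mean one, is maximal where `X > l` and zero
where `X < l`. Such a pair is a saddle-point, and its Lagrangian value `l + E(X-l)₊/(1-a)` is the
Rockafellar–Uryasev minimum, which is CVaR (`TailWeight.CVaR_eq`). Conversely the multiplier of any
saddle-point is a quantile (`IsSaddlePoint.isQuantile`), so a unique quantile determines it.

For `x` near `θ` the one-step law has a density `ρ x` with respect to the law at `θ`. Inserting the
optimal weight of one problem and the optimal level of the other into both Lagrangians sandwiches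
the increment of CVaR between two integrals under the law at `θ` (`DensityTilt.le_CVaR_sub`,
`DensityTilt.CVaR_sub_le`). To first order both test a weight against `Z = (X θ - q) • D + g`, where
`q` is the quantile, `D` the score and `g` the gradient of the next value function
(`SmoothFamily.isLittleO_integral_abs_remainder`).

In the lower bound the weight is fixed; in the upper bound it moves with `x`. Quantiles converge
where they are unique, so the moving weights converge off the level set `X θ = q`. On that set they
may oscillate, but they can be moved at vanishing L¹ cost to extremal weights
(`TailWeight.exists_near`), and these all agree against `Z`: the score part is fixed by
complementary slackness, the other part by the assumption on the reweighted next state, because `g`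
depends on that state only.

The estimates are uniform because a bounded score gives a Harnack inequality along segments, which
keeps likelihood ratios within `K * ‖x - θ‖` of one. By induction on the number of remaining
periods, value functions and their Lipschitz constants at `θ` are bounded by multiples of the
expected absolute cost, which supplies the dominating functions. -/

noncomputable section

open Filter Topology Asymptotics
open scoped RealInnerProductSpace

/-! ### Quantile functions and CVaR on the line. -/

section Quantile

variable {ν : Measure ℝ} [IsProbabilityMeasure ν]

/-- Right continuity of the distribution function means that the infimum defining `VaR` is attained.
This Galois connection replaces the definition from here on. -/
lemma VaR_le_iff {u : ℝ} (hu0 : 0 < u) (hu1 : u < 1) (x : ℝ) :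
    VaR ν u ≤ x ↔ u ≤ ν.real (Iic x) := by
  have hne : {x : ℝ | u ≤ cdf ν x}.Nonempty :=
    (((tendsto_cdf_atTop ν).eventually (eventually_ge_nhds hu1)).exists)
  have hbdd : BddBelow {x : ℝ | u ≤ cdf ν x} := by
    obtain ⟨b, hb⟩ := ((tendsto_cdf_atBot ν).eventually (eventually_lt_nhds hu0)).exists
    exact ⟨b, fun y hy => le_of_not_gt fun h => absurd (monotone_cdf ν h.le)
      (not_le.2 (hb.trans_le hy))⟩
  have hVaR : VaR ν u = sInf {x : ℝ | u ≤ cdf ν x} := by simp only [VaR, cdf_eq_real]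
  rw [hVaR, ← cdf_eq_real]
  refine ⟨fun h => ?_, fun h => csInf_le hbdd h⟩
  have hcont : Tendsto (cdf ν) (𝓝[>] x) (𝓝 (cdf ν x)) :=
    ((cdf ν).right_continuous x).mono_left (nhdsWithin_mono _ Ioi_subset_Ici_self)
  refine ge_of_tendsto hcont ?_
  filter_upwards [self_mem_nhdsWithin] with y hy
  obtain ⟨z, hz, hzy⟩ := exists_lt_of_csInf_lt hne (h.trans_lt hy)
  exact le_trans hz (monotone_cdf ν hzy.le)

lemma VaR_monotoneOn : MonotoneOn (VaR ν) (Ioo 0 1) := fun _ hu _ hv huv =>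
  (VaR_le_iff hu.1 hu.2 _).2 (huv.trans ((VaR_le_iff hv.1 hv.2 _).1 le_rfl))

lemma aemeasurable_VaR : AEMeasurable (VaR ν) (volume.restrict (Ioo 0 1)) :=
  aemeasurable_restrict_of_monotoneOn measurableSet_Ioo VaR_monotoneOn

/-- The quantile function transports the uniform distribution to `ν`. -/
lemma map_VaR : (volume.restrict (Ioo (0 : ℝ) 1)).map (VaR ν) = ν := by
  have : IsProbabilityMeasure (volume.restrict (Ioo (0 : ℝ) 1)) := ⟨by simp⟩
  have := Measure.isProbabilityMeasure_map (aemeasurable_VaR (ν := ν))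
  refine Measure.ext_of_Iic _ _ fun x => ?_
  rw [Measure.map_apply_of_aemeasurable aemeasurable_VaR measurableSet_Iic,
    Measure.restrict_apply₀' measurableSet_Ioo.nullMeasurableSet]
  have h : VaR ν ⁻¹' Iic x ∩ Ioo 0 1 = Iic (ν.real (Iic x)) ∩ Ioo 0 1 := by
    ext u
    simp only [mem_inter_iff, mem_preimage, mem_Iic, and_congr_left_iff]
    exact fun hu => VaR_le_iff hu.1 hu.2 x
  have h1 : volume (Iic (ν.real (Iic x)) ∩ Ioo 0 1) = volume (Ioc 0 (ν.real (Iic x))) := by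
    refine le_antisymm (measure_mono fun u hu => ⟨hu.2.1, hu.1⟩) ?_
    rw [Real.volume_Ioc, ← Real.volume_Ioo]
    exact measure_mono fun u hu => ⟨hu.2.le, hu.1, hu.2.trans_le measureReal_le_one⟩
  rw [h, h1, Real.volume_Ioc, sub_zero, ofReal_measureReal]

lemma integrable_VaR (hν : Integrable (fun x => x) ν) :
    IntegrableOn (VaR ν) (Ioo 0 1) := by
  rw [← map_VaR (ν := ν)] at hν
  exact hν.comp_aemeasurable aemeasurable_VaR

/-- Under the quantile transform the excess over `VaR ν a` becomes `(VaR ν u - VaR ν a)₊` with `u`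
uniform; by monotonicity it vanishes for `u ≤ a` and needs no positive part for `u > a`. -/
lemma CVaR_eq_VaR_add {a : ℝ} (ha0 : 0 < a) (ha1 : a < 1) (hν : Integrable (fun x => x) ν) :
    CVaR ν a = VaR ν a + (1 - a)⁻¹ * ∫ x, max (x - VaR ν a) 0 ∂ν := by
  set q := VaR ν a
  have hsub : Ioo a 1 ⊆ Ioo 0 1 := Ioo_subset_Ioo_left ha0.le
  have h1 : ∫ x, max (x - q) 0 ∂ν = ∫ u in Ioo a 1, (VaR ν u - q) := by
    have hm : AEStronglyMeasurable (fun x : ℝ => max (x - q) 0)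
        ((volume.restrict (Ioo (0 : ℝ) 1)).map (VaR ν)) := by fun_prop
    conv_lhs => rw [← map_VaR (ν := ν), integral_map aemeasurable_VaR hm]
    rw [← inter_eq_self_of_subset_right hsub, ← setIntegral_indicator measurableSet_Ioo]
    refine setIntegral_congr_fun measurableSet_Ioo fun u hu => ?_
    simp only [indicator]
    split_ifs with h
    · exact max_eq_left (sub_nonneg.2 (VaR_monotoneOn ⟨ha0, ha1⟩ hu h.1.le))
    · refine max_eq_right (sub_nonpos.2 (VaR_monotoneOn hu ⟨ha0, ha1⟩ ?_))
      by_contra hc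
      exact h ⟨not_le.1 hc, hu.2⟩
  rw [h1, integral_sub ((integrable_VaR hν).mono_set hsub) (by simp), CVaR,
    intervalIntegral.integral_of_le ha1.le, integral_Ioc_eq_integral_Ioo]
  have : (1 - a) ≠ 0 := (sub_pos.2 ha1).ne'
  simp only [integral_const, MeasurableSet.univ, measureReal_restrict_apply, univ_inter,
    Real.volume_real_Ioo_of_le ha1.le, smul_eq_mul]
  field_simp
  ring

lemma isQuantile_VaR {a : ℝ} (ha0 : 0 < a) (ha1 : a < 1) : IsQuantile ν a (VaR ν a) := by
  refine ⟨?_, (VaR_le_iff ha0 ha1 _).1 le_rfl⟩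
  have h : Tendsto (fun n : ℕ => ν.real (Iic (VaR ν a - 1 / ((n : ℝ) + 1)))) atTop
      (𝓝 (ν.real (Iio (VaR ν a)))) := by
    have hmono : Monotone fun n : ℕ => Iic (VaR ν a - 1 / ((n : ℝ) + 1)) := fun m n hmn =>
      Iic_subset_Iic.2 (sub_le_sub_left (Nat.one_div_le_one_div hmn) _)
    have hU : ⋃ n : ℕ, Iic (VaR ν a - 1 / ((n : ℝ) + 1)) = Iio (VaR ν a) := by
      ext x
      simp only [mem_iUnion, mem_Iic, mem_Iio]
      refine ⟨fun ⟨n, hn⟩ => hn.trans_lt (sub_lt_self _ Nat.one_div_pos_of_nat), fun hx => ?_⟩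
      obtain ⟨n, hn⟩ := exists_nat_one_div_lt (sub_pos.2 hx)
      exact ⟨n, by linarith⟩
    have := tendsto_measure_iUnion_atTop (μ := ν) hmono
    rw [hU] at this
    exact (ENNReal.tendsto_toReal (measure_ne_top _ _)).comp this
  refine le_of_tendsto' h fun n => le_of_not_ge fun hn => ?_
  have := (VaR_le_iff ha0 ha1 _).2 hn
  have h2 : (0 : ℝ) < 1 / ((n : ℝ) + 1) := Nat.one_div_pos_of_nat
  linarith

end Quantile

/-! ### Duality for CVaR: extremal weights, saddle-points and quantiles. -/

section TailWeight

variable {Y : Type*} [MeasurableSpace Y] {ν : Measure Y} {X ξ η : Y → ℝ} {a l : ℝ}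

/-- The objective of the Rockafellar–Uryasev minimisation formula for `CVaR`. -/
def excessObjective (ν : Measure Y) (X : Y → ℝ) (a l : ℝ) : ℝ :=
  l + (1 - a)⁻¹ * ∫ y, max (X y - l) 0 ∂ν

/-- `ξ` is a normalised weight putting maximal mass above the level `l` and none below. -/
structure TailWeight (ν : Measure Y) (X : Y → ℝ) (a : ℝ) (ξ : Y → ℝ) (l : ℝ) : Prop where
  measurable : Measurable ξ
  nonneg : ∀ y, 0 ≤ ξ y
  le : ∀ y, ξ y ≤ (1 - a)⁻¹
  eq_of_lt : ∀ y, l < X y → ξ y = (1 - a)⁻¹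
  eq_zero_of_lt : ∀ y, X y < l → ξ y = 0
  integral_eq_one : ∫ y, ξ y ∂ν = 1

lemma TailWeight.boxConstraint (h : TailWeight ν X a ξ l) (ν' : Measure Y) :
    BoxConstraint ν' a ξ :=
  ⟨h.measurable, .of_forall fun y => ⟨h.nonneg y, h.le y⟩⟩

lemma BoxConstraint.integrable_mul (h : BoxConstraint ν a ξ) (hX : Integrable X ν) :
    Integrable (fun y => X y * ξ y) ν := by
  refine hX.mul_bdd (c := (1 - a)⁻¹) h.1.aestronglyMeasurable ?_
  filter_upwards [h.2] with y hy
  rw [Real.norm_of_nonneg hy.1]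
  exact hy.2

lemma BoxConstraint.integrable [IsFiniteMeasure ν] (h : BoxConstraint ν a ξ) :
    Integrable ξ ν := by
  simpa using h.integrable_mul (integrable_const (1 : ℝ))

lemma BoxConstraint.mul_le (h : BoxConstraint ν a ξ) (l : ℝ) :
    ∀ᵐ y ∂ν, (X y - l) * ξ y ≤ (1 - a)⁻¹ * max (X y - l) 0 := by
  filter_upwards [h.2] with y hy
  rcases le_total 0 (X y - l) with h0 | h0
  · rw [max_eq_left h0, mul_comm]
    exact mul_le_mul_of_nonneg_right hy.2 h0
  · rw [max_eq_right h0, mul_zero]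
    exact mul_nonpos_of_nonpos_of_nonneg h0 hy.1

lemma TailWeight.mul_eq (h : TailWeight ν X a ξ l) (y : Y) :
    (X y - l) * ξ y = (1 - a)⁻¹ * max (X y - l) 0 := by
  rcases lt_trichotomy l (X y) with h0 | h0 | h0
  · rw [h.eq_of_lt y h0, max_eq_left (sub_nonneg.2 h0.le), mul_comm]
  · simp [h0]
  · rw [h.eq_zero_of_lt y h0, max_eq_right (sub_nonpos.2 h0.le), mul_zero, mul_zero]

lemma integrable_excess [IsFiniteMeasure ν] (hX : Integrable X ν) (l : ℝ) :
    Integrable (fun y => max (X y - l) 0) ν :=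
  (hX.sub (integrable_const l)).pos_part

/-- The Lagrangian is affine in the multiplier, so a minimum over all reals forces its slope to
vanish; one probe on each side suffices. -/
lemma IsSaddlePoint.integral_eq_one (h : IsSaddlePoint ν X a ξ l) : ∫ y, ξ y ∂ν = 1 := by
  have h1 := h.2.2 (l + 1)
  have h2 := h.2.2 (l - 1)
  simp only [lagrangian] at h1 h2
  linarith

variable [IsProbabilityMeasure ν]

lemma BoxConstraint.lagrangian_eq (h : BoxConstraint ν a ξ) (hX : Integrable X ν) (l : ℝ) :
    lagrangian ν X ξ l = l + ∫ y, (X y - l) * ξ y ∂ν := by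
  simp only [lagrangian, sub_mul]
  rw [integral_sub (h.integrable_mul hX) (h.integrable.const_mul l), integral_const_mul]
  ring

lemma BoxConstraint.lagrangian_le (h : BoxConstraint ν a ξ) (hX : Integrable X ν) (l : ℝ) :
    lagrangian ν X ξ l ≤ excessObjective ν X a l := by
  rw [h.lagrangian_eq hX, excessObjective, ← integral_const_mul]
  refine add_le_add_right (integral_mono_ae (h.integrable_mul (hX.sub (integrable_const l)))
    ((integrable_excess hX l).const_mul _) (h.mul_le l)) _

lemma TailWeight.lagrangian_eq (h : TailWeight ν X a ξ l) (hX : Integrable X ν) :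
    lagrangian ν X ξ l = excessObjective ν X a l := by
  rw [(h.boxConstraint ν).lagrangian_eq hX, excessObjective, ← integral_const_mul]
  simp only [h.mul_eq]

lemma TailWeight.isSaddlePoint (h : TailWeight ν X a ξ l) (hX : Integrable X ν) :
    IsSaddlePoint ν X a ξ l := by
  refine ⟨h.boxConstraint ν, fun η hη => ?_, fun r => ?_⟩
  · rw [h.lagrangian_eq hX]
    exact hη.lagrangian_le hX l
  · simp [lagrangian, h.integral_eq_one]

/-- Full weight goes above the quantile, and a fraction `κ` of it to the possible atom at the
quantile, chosen to make the mean one. -/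
lemma exists_tailWeight_VaR (hX : Measurable X) (ha0 : 0 < a) (ha1 : a < 1) :
    ∃ ξ, TailWeight ν X a ξ (VaR (ν.map X) a) := by
  have := Measure.isProbabilityMeasure_map (μ := ν) hX.aemeasurable
  obtain ⟨hq1, hq2⟩ := isQuantile_VaR (ν := ν.map X) ha0 ha1
  set q := VaR (ν.map X) a
  rw [map_measureReal_apply hX measurableSet_Iio] at hq1
  rw [map_measureReal_apply hX measurableSet_Iic] at hq2
  have hA : MeasurableSet (X ⁻¹' Ioi q) := hX measurableSet_Ioi
  have hB : MeasurableSet (X ⁻¹' {q}) := hX (measurableSet_singleton q)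
  set p₁ := ν.real (X ⁻¹' Ioi q)
  set p₂ := ν.real (X ⁻¹' {q})
  have e1 : p₁ = 1 - ν.real (X ⁻¹' Iic q) := by
    rw [← probReal_compl_eq_one_sub (hX measurableSet_Iic), ← preimage_compl, compl_Iic]
  have e2 : ν.real (X ⁻¹' Iic q) = ν.real (X ⁻¹' Iio q) + p₂ := by
    rw [← measureReal_union (Disjoint.preimage _ (by simp)) hB, ← preimage_union,
      Iio_union_right]
  have hp₂ : 0 ≤ p₂ := measureReal_nonneg
  -- The two quantile inequalities say `p₁ ≤ 1 - a ≤ p₁ + p₂`, so the missing mass is a fraction of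
  -- the atom.
  have hκ : ∃ κ : ℝ, 0 ≤ κ ∧ κ ≤ 1 ∧ p₁ + κ * p₂ = 1 - a := by
    rcases hp₂.eq_or_lt with h | h
    · exact ⟨0, le_rfl, zero_le_one, by linarith⟩
    · refine ⟨(1 - a - p₁) / p₂, div_nonneg (by linarith) hp₂, (div_le_one h).2 (by linarith), ?_⟩
      field_simp
      ring
  obtain ⟨κ, hκ0, hκ1, hκ⟩ := hκ
  have hb : 0 < (1 - a)⁻¹ := inv_pos.2 (sub_pos.2 ha1)
  set ξ : Y → ℝ := fun y => (1 - a)⁻¹ *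
    ((X ⁻¹' Ioi q).indicator (fun _ => 1) y + κ * (X ⁻¹' {q}).indicator (fun _ => 1) y) with hξ
  have hgt : ∀ y, q < X y → ξ y = (1 - a)⁻¹ := fun y hy => by simp [hξ, hy, hy.ne']
  have hlt : ∀ y, X y < q → ξ y = 0 := fun y hy => by simp [hξ, hy.le, hy.ne]
  have heq : ∀ y, X y = q → ξ y = (1 - a)⁻¹ * κ := fun y hy => by simp [hξ, hy]
  refine ⟨ξ, ?_, fun y => ?_, fun y => ?_, hgt, hlt, ?_⟩
  · exact ((measurable_const.indicator hA).add
      ((measurable_const.indicator hB).const_mul κ)).const_mul _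
  · rcases lt_trichotomy q (X y) with h | h | h
    · exact (hgt y h).symm ▸ hb.le
    · exact (heq y h.symm).symm ▸ mul_nonneg hb.le hκ0
    · exact (hlt y h).ge
  · rcases lt_trichotomy q (X y) with h | h | h
    · exact (hgt y h).le
    · exact (heq y h.symm).le.trans (mul_le_of_le_one_right hb.le hκ1)
    · exact (hlt y h).le.trans hb.le
  · simp only [hξ]
    rw [integral_const_mul, integral_add ((integrable_const _).indicator hA)
      (((integrable_const _).indicator hB).const_mul κ), integral_const_mul,
      integral_indicator_const _ hA, integral_indicator_const _ hB]
    simp only [smul_eq_mul, mul_one]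
    rw [show ν.real (X ⁻¹' Ioi q) + κ * ν.real (X ⁻¹' {q}) = 1 - a from hκ]
    exact inv_mul_cancel₀ (sub_pos.2 ha1).ne'

/-- A normalised weight has a Lagrangian independent of the level. It equals the objective at `l`
and bounds the objective from below at every `r`. -/
lemma TailWeight.excessObjective_le (h : TailWeight ν X a ξ l) (hX : Integrable X ν) (r : ℝ) :
    excessObjective ν X a l ≤ excessObjective ν X a r := by
  rw [← h.lagrangian_eq hX]
  refine le_trans ?_ ((h.boxConstraint ν).lagrangian_le hX r)
  simp [lagrangian, h.integral_eq_one]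

/-- The Rockafellar–Uryasev formula. -/
lemma TailWeight.CVaR_eq (h : TailWeight ν X a ξ l) (hXm : Measurable X) (hX : Integrable X ν)
    (ha0 : 0 < a) (ha1 : a < 1) : CVaR (ν.map X) a = excessObjective ν X a l := by
  have := Measure.isProbabilityMeasure_map (μ := ν) hXm.aemeasurable
  obtain ⟨ξ₀, h₀⟩ := exists_tailWeight_VaR (ν := ν) hXm ha0 ha1
  have hid : Integrable (fun x => x) (ν.map X) :=
    (integrable_map_measure (by fun_prop) hXm.aemeasurable).2 hX
  have h1 : CVaR (ν.map X) a = excessObjective ν X a (VaR (ν.map X) a) := by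
    rw [CVaR_eq_VaR_add ha0 ha1 hid, integral_map hXm.aemeasurable (by fun_prop), excessObjective]
  rw [h1]
  exact le_antisymm (h₀.excessObjective_le hX _) (h.excessObjective_le hX _)

/-- Complementary slackness at a saddle-point. -/
lemma IsSaddlePoint.mul_ae_eq (h : IsSaddlePoint ν X a ξ l) (hXm : Measurable X)
    (hX : Integrable X ν) (ha1 : a < 1) :
    ∀ᵐ y ∂ν, (X y - l) * ξ y = (1 - a)⁻¹ * max (X y - l) 0 := by
  have hb : 0 ≤ (1 - a)⁻¹ := (inv_pos.2 (sub_pos.2 ha1)).le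
  have hXl : Integrable (fun y => X y - l) ν := hX.sub (integrable_const l)
  -- This weight attains the pointwise bound `BoxConstraint.mul_le`. It need not have mean one,
  -- which the box does not ask. Optimality of `ξ` then forces equality of integrals, hence almost
  -- everywhere.
  set η : Y → ℝ := (X ⁻¹' Ioi l).indicator fun _ => (1 - a)⁻¹
  have hη : BoxConstraint ν a η := by
    refine ⟨measurable_const.indicator (hXm measurableSet_Ioi), .of_forall fun y => ?_⟩
    simp only [η, indicator]
    split_ifs
    exacts [⟨hb, le_rfl⟩, ⟨le_rfl, hb⟩]
  have hηe : ∀ y, (X y - l) * η y = (1 - a)⁻¹ * max (X y - l) 0 := fun y => by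
    by_cases hy : l < X y
    · simp [η, hy, hy.le, mul_comm]
    · simp [η, hy, max_eq_right (sub_nonpos.2 (not_lt.1 hy))]
  have h1 := h.2.1 η hη
  rw [hη.lagrangian_eq hX, h.1.lagrangian_eq hX, add_le_add_iff_left] at h1
  simp only [hηe] at h1
  have h2 := (h.1.integrable_mul hXl)
  have h3 := (integrable_excess hX l).const_mul (1 - a)⁻¹
  exact (integral_eq_iff_of_ae_le h2 h3 (h.1.mul_le l)).1
    (le_antisymm (integral_mono_ae h2 h3 (h.1.mul_le l)) h1)

/-- By slackness `ξ` is maximal above `l` and zero below, so its total mass one lies between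
`(1-a)⁻¹` times the probabilities of `X > l` and of `X ≥ l`. -/
lemma IsSaddlePoint.isQuantile (h : IsSaddlePoint ν X a ξ l) (hXm : Measurable X)
    (hX : Integrable X ν) (ha1 : a < 1) : IsQuantile (ν.map X) a l := by
  have ha : 0 < 1 - a := sub_pos.2 ha1
  have hb : 0 < (1 - a)⁻¹ := inv_pos.2 ha
  have hint := h.1.integrable
  have hA : MeasurableSet (X ⁻¹' Ioi l) := hXm measurableSet_Ioi
  have hB : MeasurableSet (X ⁻¹' Ici l) := hXm measurableSet_Ici
  have h1 : (1 - a)⁻¹ * ν.real (X ⁻¹' Ioi l) ≤ ∫ y, ξ y ∂ν := by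
    rw [mul_comm, ← smul_eq_mul, ← integral_indicator_const _ hA]
    refine integral_mono_ae ((integrable_const _).indicator hA) hint ?_
    filter_upwards [h.mul_ae_eq hXm hX ha1, h.1.2] with y hy hy'
    by_cases hl : l < X y
    · have hl' := sub_pos.2 hl
      rw [max_eq_left hl'.le, mul_comm, mul_left_inj' hl'.ne'] at hy
      simp [hl, hy]
    · simpa [hl] using hy'.1
  have h2 : ∫ y, ξ y ∂ν ≤ (1 - a)⁻¹ * ν.real (X ⁻¹' Ici l) := by
    rw [mul_comm, ← smul_eq_mul, ← integral_indicator_const _ hB]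
    refine integral_mono_ae hint ((integrable_const _).indicator hB) ?_
    filter_upwards [h.mul_ae_eq hXm hX ha1, h.1.2] with y hy hy'
    by_cases hl : l ≤ X y
    · simpa [hl] using hy'.2
    · have hl' := sub_neg.2 (not_le.1 hl)
      rw [max_eq_right hl'.le, mul_zero, mul_eq_zero, or_iff_right hl'.ne] at hy
      simp [hl, hy]
  rw [h.integral_eq_one, inv_mul_eq_div] at h1 h2
  rw [div_le_one ha] at h1
  rw [le_div_iff₀ ha] at h2
  have e1 : ν.real (X ⁻¹' Ioi l) = 1 - ν.real (X ⁻¹' Iic l) := by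
    rw [← probReal_compl_eq_one_sub (hXm measurableSet_Iic), ← preimage_compl, compl_Iic]
  have e2 : ν.real (X ⁻¹' Ici l) = 1 - ν.real (X ⁻¹' Iio l) := by
    rw [← probReal_compl_eq_one_sub (hXm measurableSet_Iio), ← preimage_compl, compl_Iio]
  rw [IsQuantile, map_measureReal_apply hXm measurableSet_Iio,
    map_measureReal_apply hXm measurableSet_Iic]
  constructor <;> linarith

/-- Markov's inequality for `|X|`: if `l ≥ 0`, then `X ≥ l` has probability at least `1 - a`; if `l
≤ 0`, then `X ≤ l` has probability at least `a`. -/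
lemma TailWeight.abs_level_le (h : TailWeight ν X a ξ l) (hXm : Measurable X)
    (hX : Integrable X ν) (ha0 : 0 < a) (ha1 : a < 1) :
    |l| ≤ (a⁻¹ + (1 - a)⁻¹) * ∫ y, |X y| ∂ν := by
  have ha : 0 < 1 - a := sub_pos.2 ha1
  obtain ⟨h1, h2⟩ := (h.isSaddlePoint hX).isQuantile hXm hX ha1
  rw [map_measureReal_apply hXm measurableSet_Iio] at h1
  rw [map_measureReal_apply hXm measurableSet_Iic] at h2
  have e2 : ν.real (X ⁻¹' Ici l) = 1 - ν.real (X ⁻¹' Iio l) := by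
    rw [← probReal_compl_eq_one_sub (hXm measurableSet_Iio), ← preimage_compl, compl_Iio]
  have hE : 0 ≤ ∫ y, |X y| ∂ν := integral_nonneg fun y => abs_nonneg _
  have key : ∀ s : Set ℝ, (∀ x ∈ s, |l| ≤ |x|) → |l| * ν.real (X ⁻¹' s) ≤ ∫ y, |X y| ∂ν := by
    intro s hs
    refine le_trans (mul_le_mul_of_nonneg_left (measureReal_mono fun y hy => hs _ hy) (abs_nonneg l))
      (mul_meas_ge_le_integral_of_nonneg (.of_forall fun y => abs_nonneg (X y)) hX.abs |l|)
  rcases le_total 0 l with h0 | h0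
  · have := key (Ici l) fun x hx => abs_le_abs_of_nonneg h0 hx
    have h3 : |l| * (1 - a) ≤ ∫ y, |X y| ∂ν :=
      (mul_le_mul_of_nonneg_left (by linarith) (abs_nonneg l)).trans this
    rw [← le_div_iff₀ ha] at h3
    refine h3.trans ?_
    rw [add_mul, inv_mul_eq_div, inv_mul_eq_div]
    exact le_add_of_nonneg_left (by positivity)
  · have := key (Iic l) fun x hx => abs_le_abs_of_nonpos h0 hx
    have h3 : |l| * a ≤ ∫ y, |X y| ∂ν :=
      (mul_le_mul_of_nonneg_left h2 (abs_nonneg l)).trans this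
    rw [← le_div_iff₀ ha0] at h3
    refine h3.trans ?_
    rw [add_mul, inv_mul_eq_div, inv_mul_eq_div]
    exact le_add_of_nonneg_right (by positivity)

lemma abs_CVaR_le (hXm : Measurable X) (hX : Integrable X ν) (ha0 : 0 < a) (ha1 : a < 1) :
    |CVaR (ν.map X) a| ≤ (1 - a)⁻¹ * ∫ y, |X y| ∂ν := by
  obtain ⟨ξ, h⟩ := exists_tailWeight_VaR (ν := ν) hXm ha0 ha1
  rw [h.CVaR_eq hXm hX ha0 ha1, ← h.lagrangian_eq hX, lagrangian, h.integral_eq_one, sub_self,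
    mul_zero, sub_zero, ← integral_const_mul]
  refine (abs_integral_le_integral_abs).trans (integral_mono
    ((h.boxConstraint ν).integrable_mul hX).abs (hX.abs.const_mul _) fun y => ?_)
  simp only [abs_mul, abs_of_nonneg (h.nonneg y)]
  rw [mul_comm]
  exact mul_le_mul_of_nonneg_right (h.le y) (abs_nonneg _)

lemma excessObjective_convex (hX : Integrable X ν) (ha1 : a < 1) :
    ConvexOn ℝ univ (excessObjective ν X a) := by
  refine ⟨convex_univ, fun x _ y _ s t hs ht hst => ?_⟩
  have hb : 0 ≤ (1 - a)⁻¹ := (inv_pos.2 (sub_pos.2 ha1)).le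
  simp only [excessObjective, smul_eq_mul]
  have : ∫ z, max (X z - (s * x + t * y)) 0 ∂ν ≤
      s * ∫ z, max (X z - x) 0 ∂ν + t * ∫ z, max (X z - y) 0 ∂ν := by
    rw [← integral_const_mul, ← integral_const_mul, ← integral_add
      ((integrable_excess hX x).const_mul s) ((integrable_excess hX y).const_mul t)]
    refine integral_mono (integrable_excess hX _) (((integrable_excess hX x).const_mul s).add
      ((integrable_excess hX y).const_mul t)) fun z => max_le ?_ (by positivity)
    have h1 := mul_le_mul_of_nonneg_left (le_max_left (X z - x) 0) hs
    have h2 := mul_le_mul_of_nonneg_left (le_max_left (X z - y) 0) ht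
    have h3 : X z = s * X z + t * X z := by rw [← add_mul, hst, one_mul]
    linarith
  have := mul_le_mul_of_nonneg_left this hb
  linarith

/-- The level is the only minimiser of the objective if the quantile is unique. -/
lemma TailWeight.excessObjective_lt (h : TailWeight ν X a ξ l) (hXm : Measurable X)
    (hX : Integrable X ν) (ha1 : a < 1)
    (hq : ∀ x x', IsQuantile (ν.map X) a x → IsQuantile (ν.map X) a x' → x = x')
    {r : ℝ} (hr : r ≠ l) : excessObjective ν X a l < excessObjective ν X a r := by
  refine (h.excessObjective_le hX r).lt_of_ne fun he => hr ?_
  have hL : ∀ r', lagrangian ν X ξ r' = lagrangian ν X ξ l := fun r' => by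
    simp [lagrangian, h.integral_eq_one]
  -- A second minimiser `r` would form a saddle-point with the same `ξ`, and so be a second
  -- quantile.
  have hs : IsSaddlePoint ν X a ξ r := by
    refine ⟨h.boxConstraint ν, fun η hη => ?_, fun r' => by rw [hL, hL r']⟩
    rw [hL, h.lagrangian_eq hX, he]
    exact hη.lagrangian_le hX r
  exact hq _ _ (hs.isQuantile hXm hX ha1) ((h.isSaddlePoint hX).isQuantile hXm hX ha1)

end TailWeight

/-! ### Comparing CVaR under two laws with bounded relative density. -/

section DensityTilt

variable {Y : Type*} [MeasurableSpace Y] {ν ν' : Measure Y} {ρ : Y → ℝ} {δ : ℝ}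

/-- `ν'` has a density `ρ` with respect to `ν` that is uniformly `δ`-close to `1`. -/
structure DensityTilt (ν ν' : Measure Y) (ρ : Y → ℝ) (δ : ℝ) : Prop where
  measurable : Measurable ρ
  nonneg : ∀ y, 0 ≤ ρ y
  abs_sub_one_le : ∀ y, |ρ y - 1| ≤ δ
  eq_withDensity : ν' = ν.withDensity fun y => ENNReal.ofReal (ρ y)

namespace DensityTilt

lemma le (h : DensityTilt ν ν' ρ δ) (y : Y) : ρ y ≤ 1 + δ := by
  linarith [(abs_le.1 (h.abs_sub_one_le y)).2]

lemma integral_eq (h : DensityTilt ν ν' ρ δ) (f : Y → ℝ) : ∫ y, f y ∂ν' = ∫ y, ρ y * f y ∂ν := by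
  rw [h.eq_withDensity, integral_withDensity_eq_integral_toReal_smul
    h.measurable.ennreal_ofReal (.of_forall fun _ => ENNReal.ofReal_lt_top)]
  simp [ENNReal.toReal_ofReal (h.nonneg _)]

lemma integrable_mul (h : DensityTilt ν ν' ρ δ) {f : Y → ℝ} (hf : Integrable f ν) :
    Integrable (fun y => ρ y * f y) ν := by
  refine hf.bdd_mul (c := 1 + δ) h.measurable.aestronglyMeasurable (.of_forall fun y => ?_)
  rw [Real.norm_of_nonneg (h.nonneg y)]
  exact h.le y

lemma integrable (h : DensityTilt ν ν' ρ δ) {f : Y → ℝ} (hf : Integrable f ν) : Integrable f ν' := by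
  rw [h.eq_withDensity, integrable_withDensity_iff h.measurable.ennreal_ofReal
    (.of_forall fun _ => ENNReal.ofReal_lt_top)]
  simpa [ENNReal.toReal_ofReal (h.nonneg _), mul_comm] using h.integrable_mul hf

variable {X X' ξ ξ' : Y → ℝ} {a l l' : ℝ}

lemma integral_abs_le (h : DensityTilt ν ν' ρ δ) (hX : Integrable X ν) (hX' : Integrable X' ν) :
    ∫ y, |X' y| ∂ν' ≤ (1 + δ) * (∫ y, |X y| ∂ν + ∫ y, |X' y - X y| ∂ν) := by
  have hd : Integrable (fun y => |X' y - X y|) ν := (hX'.sub hX).abs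
  rw [h.integral_eq, ← integral_add hX.abs hd, ← integral_const_mul]
  refine integral_mono (h.integrable_mul hX'.abs) ((hX.abs.add hd).const_mul _)
    fun y => mul_le_mul (h.le y) ?_ (abs_nonneg _) ((h.nonneg y).trans (h.le y))
  calc |X' y| = |X y + (X' y - X y)| := by ring_nf
    _ ≤ |X y| + |X' y - X y| := abs_add_le _ _

variable [IsProbabilityMeasure ν]

/-- The integrand splits as `(ρ - 1)(X - r) + ρ(X' - X)`: the first part is small because the laws
are close, the second because the variables are. -/
lemma abs_integral_mul_le (h : DensityTilt ν ν' ρ δ) (hX : Integrable X ν) (hX' : Integrable X' ν)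
    {η : Y → ℝ} (hη : BoxConstraint ν a η) (ha1 : a < 1) (r : ℝ) :
    |∫ y, (ρ y * (X' y - r) - (X y - r)) * η y ∂ν| ≤
      (1 - a)⁻¹ * (δ * (∫ y, |X y| ∂ν + |r|) + (1 + δ) * ∫ y, |X' y - X y| ∂ν) := by
  have hb : 0 ≤ (1 - a)⁻¹ := (inv_pos.2 (sub_pos.2 ha1)).le
  have hX1 : Integrable (fun y => |X y| + |r|) ν := hX.abs.add (integrable_const _)
  have hX2 : Integrable (fun y => |X' y - X y|) ν := (hX'.sub hX).abs
  have e : (1 - a)⁻¹ * (δ * (∫ y, |X y| ∂ν + |r|) + (1 + δ) * ∫ y, |X' y - X y| ∂ν) =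
      ∫ y, (δ * (|X y| + |r|) + (1 + δ) * |X' y - X y|) * (1 - a)⁻¹ ∂ν := by
    rw [integral_mul_const, integral_add (hX1.const_mul _) (hX2.const_mul _), integral_const_mul, integral_const_mul,
      integral_add hX.abs (integrable_const _)]
    simp [mul_comm]
  rw [e]
  have hi : Integrable (fun y => ρ y * (X' y - r) - (X y - r)) ν :=
    (h.integrable_mul (hX'.sub (integrable_const r))).sub (hX.sub (integrable_const r))
  refine abs_integral_le_integral_abs.trans (integral_mono_ae (hη.integrable_mul hi).abs
    (((hX1.const_mul _).add (hX2.const_mul _)).mul_const _) ?_)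
  filter_upwards [hη.2] with y hy
  rw [abs_mul, abs_of_nonneg hy.1]
  have hδ : 0 ≤ δ := (abs_nonneg _).trans (h.abs_sub_one_le y)
  refine mul_le_mul ?_ hy.2 hy.1 (by positivity)
  calc |ρ y * (X' y - r) - (X y - r)| = |(ρ y - 1) * (X y - r) + ρ y * (X' y - X y)| := by ring_nf
    _ ≤ |ρ y - 1| * |X y - r| + ρ y * |X' y - X y| := by
      rw [← abs_mul, ← abs_of_nonneg (h.nonneg y), ← abs_mul, abs_of_nonneg (h.nonneg y)]
      exact abs_add_le _ _
    _ ≤ _ := add_le_add (mul_le_mul (h.abs_sub_one_le y) (abs_sub _ _) (abs_nonneg _) hδ)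
      (mul_le_mul_of_nonneg_right (h.le y) (abs_nonneg _))

variable [IsProbabilityMeasure ν']

lemma lagrangian_sub_lagrangian (h : DensityTilt ν ν' ρ δ) (hX : Integrable X ν) (hX' : Integrable X' ν)
    {η : Y → ℝ} (hη : ∀ ν'' : Measure Y, BoxConstraint ν'' a η) (r : ℝ) :
    lagrangian ν' X' η r - lagrangian ν X η r =
      ∫ y, (ρ y * (X' y - r) - (X y - r)) * η y ∂ν := by
  have h1 : Integrable (fun y => ρ y * ((X' y - r) * η y)) ν :=
    h.integrable_mul ((hη ν).integrable_mul (hX'.sub (integrable_const r)))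
  have h2 : Integrable (fun y => (X y - r) * η y) ν :=
    (hη ν).integrable_mul (hX.sub (integrable_const r))
  rw [(hη ν').lagrangian_eq (h.integrable hX'), (hη ν).lagrangian_eq hX, h.integral_eq,
    add_sub_add_left_eq_sub, ← integral_sub h1 h2]
  congr with y
  ring

/-- Both Lagrangians are evaluated at the mixed pair `(ξ', l)`. Under `ν'` replacing `l'` by `l`
costs nothing, since `ξ'` is normalised there; under `ν` the weight `ξ'` is merely in the box, which
gives an inequality in the right direction. -/
lemma CVaR_sub_le (h : DensityTilt ν ν' ρ δ) (hXm : Measurable X) (hX : Integrable X ν)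
    (hXm' : Measurable X') (hX' : Integrable X' ν) (ha0 : 0 < a) (ha1 : a < 1)
    (hξ : TailWeight ν X a ξ l) (hξ' : TailWeight ν' X' a ξ' l') :
    CVaR (ν'.map X') a - CVaR (ν.map X) a ≤
      ∫ y, (ρ y * (X' y - l) - (X y - l)) * ξ' y ∂ν := by
  rw [hξ.CVaR_eq hXm hX ha0 ha1, hξ'.CVaR_eq hXm' (h.integrable hX') ha0 ha1,
    ← h.lagrangian_sub_lagrangian hX hX' hξ'.boxConstraint]
  refine sub_le_sub ?_ ((hξ'.boxConstraint ν).lagrangian_le hX l)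
  rw [← hξ'.lagrangian_eq (h.integrable hX')]
  simp [lagrangian, hξ'.integral_eq_one]

/-- The mirror image of `CVaR_sub_le`, with the mixed pair `(ξ, l')`. -/
lemma le_CVaR_sub (h : DensityTilt ν ν' ρ δ) (hXm : Measurable X) (hX : Integrable X ν)
    (hXm' : Measurable X') (hX' : Integrable X' ν) (ha0 : 0 < a) (ha1 : a < 1)
    (hξ : TailWeight ν X a ξ l) (hξ' : TailWeight ν' X' a ξ' l') :
    ∫ y, (ρ y * (X' y - l') - (X y - l')) * ξ y ∂ν ≤
      CVaR (ν'.map X') a - CVaR (ν.map X) a := by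
  rw [hξ.CVaR_eq hXm hX ha0 ha1, hξ'.CVaR_eq hXm' (h.integrable hX') ha0 ha1,
    ← h.lagrangian_sub_lagrangian hX hX' hξ.boxConstraint]
  refine sub_le_sub ((hξ.boxConstraint ν').lagrangian_le (h.integrable hX') l') ?_
  rw [← hξ.lagrangian_eq hX]
  simp [lagrangian, hξ.integral_eq_one]

/-- Stability of `CVaR` under tilting of the measure and perturbation of the random variable. -/
lemma abs_CVaR_sub_le (h : DensityTilt ν ν' ρ δ) (hXm : Measurable X) (hX : Integrable X ν)
    (hXm' : Measurable X') (hX' : Integrable X' ν) (ha0 : 0 < a) (ha1 : a < 1) :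
    |CVaR (ν'.map X') a - CVaR (ν.map X) a| ≤
      (1 - a)⁻¹ * (δ * (∫ y, |X y| ∂ν + (a⁻¹ + (1 - a)⁻¹) *
        ((1 + δ) * (∫ y, |X y| ∂ν + ∫ y, |X' y - X y| ∂ν))) +
        (1 + δ) * ∫ y, |X' y - X y| ∂ν) := by
  obtain ⟨ξ, hξ⟩ := exists_tailWeight_VaR (ν := ν) hXm ha0 ha1
  obtain ⟨ξ', hξ'⟩ := exists_tailWeight_VaR (ν := ν') hXm' ha0 ha1
  have hb : 0 ≤ (1 - a)⁻¹ := (inv_pos.2 (sub_pos.2 ha1)).le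
  obtain ⟨y⟩ : Nonempty Y := nonempty_of_isProbabilityMeasure ν
  have hδ : 0 ≤ δ := (abs_nonneg _).trans (h.abs_sub_one_le y)
  have hM : 0 ≤ a⁻¹ + (1 - a)⁻¹ := by positivity
  have h1 : 0 ≤ ∫ y, |X y| ∂ν := integral_nonneg fun y => abs_nonneg _
  have h2 : 0 ≤ ∫ y, |X' y - X y| ∂ν := integral_nonneg fun y => abs_nonneg _
  have hl' := (hξ'.abs_level_le hXm' (h.integrable hX') ha0 ha1).trans
    (mul_le_mul_of_nonneg_left (h.integral_abs_le hX hX') hM)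
  have hl := (hξ.abs_level_le hXm hX ha0 ha1).trans (mul_le_mul_of_nonneg_left
    (show ∫ y, |X y| ∂ν ≤ (1 + δ) * (∫ y, |X y| ∂ν + ∫ y, |X' y - X y| ∂ν) by nlinarith) hM)
  have e1 := h.CVaR_sub_le hXm hX hXm' hX' ha0 ha1 hξ hξ'
  have e2 := h.le_CVaR_sub hXm hX hXm' hX' ha0 ha1 hξ hξ'
  have e3 := abs_le.1 (h.abs_integral_mul_le hX hX' (hξ'.boxConstraint ν) ha1
    (VaR (ν.map X) a))
  have e4 := abs_le.1 (h.abs_integral_mul_le hX hX' (hξ.boxConstraint ν) ha1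
    (VaR (ν'.map X') a))
  refine abs_le.2 ⟨le_trans (neg_le_neg ?_) (e4.1.trans e2), (e1.trans e3.2).trans ?_⟩ <;> gcongr

end DensityTilt

end DensityTilt

/-! ### Convergence of nearly optimal weights. -/

section WeightConvergence

variable {Y : Type*} [MeasurableSpace Y] {ν : Measure Y}

/-- Scaling `ξ` down changes it with one sign only, so the L¹ distance equals the change of mass. -/
lemma exists_integral_eq_of_le [IsFiniteMeasure ν] {b m : ℝ} {ξ : Y → ℝ}
    (hξm : Measurable ξ) (hξ0 : ∀ y, 0 ≤ ξ y) (hξb : ∀ y, ξ y ≤ b) (hm : 0 ≤ m)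
    (hmξ : m ≤ ∫ y, ξ y ∂ν) :
    ∃ η : Y → ℝ, Measurable η ∧ (∀ y, 0 ≤ η y) ∧ (∀ y, η y ≤ b) ∧ ∫ y, η y ∂ν = m ∧
      ∫ y, |ξ y - η y| ∂ν = |∫ y, ξ y ∂ν - m| := by
  have h0 : 0 ≤ ∫ y, ξ y ∂ν := hm.trans hmξ
  set t := m / ∫ y, ξ y ∂ν
  have ht0 : 0 ≤ t := div_nonneg hm h0
  have ht1 : t ≤ 1 := div_le_one_of_le₀ hmξ h0
  have htm : t * ∫ y, ξ y ∂ν = m := by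
    rcases h0.eq_or_lt with h | h
    · rw [← h] at hmξ ⊢
      rw [mul_zero, le_antisymm hmξ hm]
    · exact div_mul_cancel₀ _ h.ne'
  refine ⟨fun y => t * ξ y, hξm.const_mul t, fun y => mul_nonneg ht0 (hξ0 y),
    fun y => (mul_le_of_le_one_left (hξ0 y) ht1).trans (hξb y), ?_, ?_⟩
  · rw [integral_const_mul, htm]
  · have : ∀ y, |ξ y - t * ξ y| = (1 - t) * ξ y := fun y => by
      rw [← one_sub_mul, abs_of_nonneg (mul_nonneg (sub_nonneg.2 ht1) (hξ0 y))]
    simp only [this]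
    rw [integral_const_mul, one_sub_mul, htm, abs_of_nonneg (sub_nonneg.2 hmξ)]

/-- When mass must be added, the scaling argument is applied to the complement `b - ξ`. -/
lemma exists_integral_eq [IsFiniteMeasure ν] {b m : ℝ} {ξ : Y → ℝ}
    (hξm : Measurable ξ) (hξ0 : ∀ y, 0 ≤ ξ y) (hξb : ∀ y, ξ y ≤ b) (hm : 0 ≤ m)
    (hmb : m ≤ b * ν.real univ) :
    ∃ η : Y → ℝ, Measurable η ∧ (∀ y, 0 ≤ η y) ∧ (∀ y, η y ≤ b) ∧ ∫ y, η y ∂ν = m ∧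
      ∫ y, |ξ y - η y| ∂ν = |∫ y, ξ y ∂ν - m| := by
  rcases le_total m (∫ y, ξ y ∂ν) with h | h
  · exact exists_integral_eq_of_le hξm hξ0 hξb hm h
  · have hξi : Integrable ξ ν := .of_bound hξm.aestronglyMeasurable b (.of_forall fun y => by
      rw [Real.norm_of_nonneg (hξ0 y)]
      exact hξb y)
    have hi : ∀ f : Y → ℝ, Integrable f ν →
        ∫ y, (b - f y) ∂ν = b * ν.real univ - ∫ y, f y ∂ν := fun f hf => by
      rw [integral_sub (integrable_const b) hf, integral_const, smul_eq_mul, mul_comm]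
    obtain ⟨η, h1, h2, h3, h4, h5⟩ := exists_integral_eq_of_le (ν := ν) (b := b)
      (m := b * ν.real univ - m) (ξ := fun y => b - ξ y) (hξm.const_sub b)
      (fun y => sub_nonneg.2 (hξb y)) (fun y => sub_le_self _ (hξ0 y)) (sub_nonneg.2 hmb)
      (by rw [hi ξ hξi]; linarith)
    have hηi : Integrable η ν := .of_bound h1.aestronglyMeasurable b (.of_forall fun y => by
      rw [Real.norm_of_nonneg (h2 y)]
      exact h3 y)
    refine ⟨fun y => b - η y, h1.const_sub b, fun y => sub_nonneg.2 (h3 y),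
      fun y => sub_le_self _ (h2 y), ?_, ?_⟩
    · rw [hi η hηi, h4, sub_sub_cancel]
    · rw [hi ξ hξi] at h5
      rw [abs_sub_comm, ← sub_sub_sub_cancel_left _ _ (b * ν.real univ), ← h5]
      congr with y
      rw [abs_sub_comm]
      congr 1
      ring

/-- A weight can be moved to an extremal weight at the cost of its distance to the extremal weights
off the level set. -/
lemma TailWeight.exists_near [IsProbabilityMeasure ν] {X ξ₀ ξ : Y → ℝ} {a q : ℝ}
    (h₀ : TailWeight ν X a ξ₀ q) (hXm : Measurable X)
    (hξm : Measurable ξ) (hξ0 : ∀ y, 0 ≤ ξ y) (hξb : ∀ y, ξ y ≤ (1 - a)⁻¹) :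
    ∃ η, TailWeight ν X a η q ∧ ∫ y, |ξ y - η y| ∂ν ≤
      |∫ y, ξ y ∂ν - 1| + 2 * ∫ y in (X ⁻¹' {q})ᶜ, |ξ y - ξ₀ y| ∂ν := by
  set A := X ⁻¹' {q}
  have hA : MeasurableSet A := hXm (measurableSet_singleton q)
  have hbox : ∀ f : Y → ℝ, Measurable f → (∀ y, 0 ≤ f y) → (∀ y, f y ≤ (1 - a)⁻¹) →
      Integrable f ν := fun f h1 h2 h3 =>
    BoxConstraint.integrable (a := a) ⟨h1, .of_forall fun y => ⟨h2 y, h3 y⟩⟩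
  have hi := hbox ξ hξm hξ0 hξb
  have hi₀ := hbox ξ₀ h₀.measurable h₀.nonneg h₀.le
  -- On the level set an extremal weight is constrained only through its total mass there. So `ξ` is
  -- corrected on that set to the mass of `ξ₀` and replaced by `ξ₀` elsewhere.
  obtain ⟨η, h1, h2, h3, h4, h5⟩ := exists_integral_eq (ν := ν.restrict A)
    (m := ∫ y in A, ξ₀ y ∂ν) hξm hξ0 hξb (integral_nonneg h₀.nonneg) (by
      calc ∫ y in A, ξ₀ y ∂ν ≤ ∫ y in A, (1 - a)⁻¹ ∂ν :=
            integral_mono hi₀.restrict (integrable_const _) h₀.le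
        _ = _ := by rw [integral_const, smul_eq_mul, mul_comm])
  classical
  set ζ := A.piecewise η ξ₀
  have hζA : ∀ y ∈ A, ζ y = η y := fun y hy => piecewise_eq_of_mem _ _ _ hy
  have hζA' : ∀ y ∉ A, ζ y = ξ₀ y := fun y hy => piecewise_eq_of_notMem _ _ _ hy
  have hζm : Measurable ζ := h1.piecewise hA h₀.measurable
  have hζ0 : ∀ y, 0 ≤ ζ y := fun y => by
    by_cases hy : y ∈ A
    · exact hζA y hy ▸ h2 y
    · exact hζA' y hy ▸ h₀.nonneg y
  have hζb : ∀ y, ζ y ≤ (1 - a)⁻¹ := fun y => by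
    by_cases hy : y ∈ A
    · exact hζA y hy ▸ h3 y
    · exact hζA' y hy ▸ h₀.le y
  have hiζ := hbox ζ hζm hζ0 hζb
  have hid : Integrable (fun y => |ξ y - ζ y|) ν := (hi.sub hiζ).abs
  refine ⟨ζ, ⟨hζm, hζ0, hζb, fun y hy => ?_, fun y hy => ?_, ?_⟩, ?_⟩
  · rw [hζA' y hy.ne', h₀.eq_of_lt y hy]
  · rw [hζA' y hy.ne, h₀.eq_zero_of_lt y hy]
  · rw [← integral_add_compl hA hiζ, setIntegral_congr_fun hA hζA,
      setIntegral_congr_fun hA.compl hζA', h4, integral_add_compl hA hi₀, h₀.integral_eq_one]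
  · rw [← integral_add_compl hA hid,
      setIntegral_congr_fun hA (g := fun y => |ξ y - η y|) fun y hy => by simp only [hζA y hy],
      setIntegral_congr_fun hA.compl (g := fun y => |ξ y - ξ₀ y|)
        fun y hy => by simp only [hζA' y hy], h5]
    -- The mass defect on the level set is the global defect minus the defect off it. The latter
    -- adds to the off-level distance already present, hence the factor 2.
    have e : ∫ y in A, ξ y ∂ν - ∫ y in A, ξ₀ y ∂ν =
        (∫ y, ξ y ∂ν - 1) - ∫ y in Aᶜ, (ξ y - ξ₀ y) ∂ν := by
      rw [integral_sub hi.restrict hi₀.restrict, ← h₀.integral_eq_one, ← integral_add_compl hA hi,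
        ← integral_add_compl hA hi₀]
      ring
    rw [e]
    have := abs_sub (∫ y, ξ y ∂ν - 1) (∫ y in Aᶜ, (ξ y - ξ₀ y) ∂ν)
    have h6 : |∫ y in Aᶜ, (ξ y - ξ₀ y) ∂ν| ≤ ∫ y in Aᶜ, |ξ y - ξ₀ y| ∂ν :=
      abs_integral_le_integral_abs
    linarith

variable {ι E : Type*} {𝓕 : Filter ι} [NormedAddCommGroup E] [NormedSpace ℝ E]

/-- Bounded functions that vanish in mean vanish when tested against an integrable function. -/
lemma tendsto_integral_smul_of_tendsto_integral_abs [IsFiniteMeasure ν] {ζ : ι → Y → ℝ} {K : ℝ}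
    (hm : ∀ᶠ i in 𝓕, Measurable (ζ i)) (hK : ∀ᶠ i in 𝓕, ∀ y, |ζ i y| ≤ K)
    (h : Tendsto (fun i => ∫ y, |ζ i y| ∂ν) 𝓕 (𝓝 0)) {Z : Y → E} (hZ : Integrable Z ν) :
    Tendsto (fun i => ∫ y, ζ i y • Z y ∂ν) 𝓕 (𝓝 0) := by
  -- Truncation: `‖Z‖ ≤ M + (‖Z‖ - M)₊`. The excess is controlled by the uniform bound on the
  -- weights, the bounded part by their L¹ convergence.
  have hM : Tendsto (fun M : ℕ => |K| * ∫ y, max (‖Z y‖ - M) 0 ∂ν) atTop (𝓝 (|K| * 0)) := by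
    refine Tendsto.const_mul _ ?_
    suffices h : Tendsto (fun M : ℕ => ∫ y, max (‖Z y‖ - M) 0 ∂ν) atTop
      (𝓝 (∫ _, (0 : ℝ) ∂ν)) by simpa using h
    refine tendsto_integral_of_dominated_convergence (fun y => ‖Z y‖) (fun M => ?_) hZ.norm
      (fun M => .of_forall fun y => ?_) (.of_forall fun y => ?_)
    · exact (hZ.norm.sub (integrable_const _)).pos_part.aestronglyMeasurable
    · rw [Real.norm_of_nonneg (le_max_right _ _)]
      exact max_le (sub_le_self _ (Nat.cast_nonneg M)) (norm_nonneg _)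
    · obtain ⟨N, hN⟩ := exists_nat_ge ‖Z y‖
      refine tendsto_const_nhds.congr' ?_
      filter_upwards [eventually_ge_atTop N] with M hMN
      exact (max_eq_right (sub_nonpos.2 (hN.trans (Nat.cast_le.2 hMN)))).symm
  rw [mul_zero] at hM
  rw [tendsto_zero_iff_norm_tendsto_zero, Metric.tendsto_nhds]
  intro ε hε
  obtain ⟨M, hM⟩ := (hM.eventually (gt_mem_nhds (half_pos hε))).exists
  have h' := h.const_mul (M : ℝ)
  rw [mul_zero] at h'
  filter_upwards [hm, hK, h'.eventually (gt_mem_nhds (half_pos hε))] with i h1 h2 h3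
  rw [Real.dist_0_eq_abs, abs_of_nonneg (norm_nonneg _)]
  have hi : Integrable (ζ i) ν := .of_bound h1.aestronglyMeasurable K (.of_forall h2)
  have hiM : Integrable (fun y => max (‖Z y‖ - M) 0) ν :=
    (hZ.norm.sub (integrable_const (M : ℝ))).pos_part
  calc ‖∫ y, ζ i y • Z y ∂ν‖ ≤ ∫ y, ((M : ℝ) * |ζ i y| + |K| * max (‖Z y‖ - M) 0) ∂ν := by
        refine norm_integral_le_of_norm_le ((hi.abs.const_mul _).add (hiM.const_mul _))
          (.of_forall fun y => ?_)
        rw [norm_smul, Real.norm_eq_abs]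
        have e1 : ‖Z y‖ ≤ M + max (‖Z y‖ - M) 0 := by linarith [le_max_left (‖Z y‖ - M) 0]
        have e2 := mul_le_mul_of_nonneg_left e1 (abs_nonneg (ζ i y))
        have e3 := mul_le_mul_of_nonneg_right ((h2 y).trans (le_abs_self K))
          (le_max_right (‖Z y‖ - M) 0)
        linarith
    _ = (M : ℝ) * ∫ y, |ζ i y| ∂ν + |K| * ∫ y, max (‖Z y‖ - M) 0 ∂ν := by
        rw [integral_add (hi.abs.const_mul _) (hiM.const_mul _), integral_const_mul,
          integral_const_mul]
    _ < ε := by linarith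

/-- Weights that converge to an extremal weight off the level set converge when tested against a
function that does not distinguish the extremal weights. -/
lemma TailWeight.tendsto_integral_smul [IsProbabilityMeasure ν] [𝓕.IsCountablyGenerated]
    {X ξ₀ : Y → ℝ} {a q : ℝ} (h₀ : TailWeight ν X a ξ₀ q) (hXm : Measurable X)
    {ξ : ι → Y → ℝ} (hm : ∀ᶠ i in 𝓕, Measurable (ξ i))
    (h0 : ∀ᶠ i in 𝓕, ∀ y, 0 ≤ ξ i y) (hb : ∀ᶠ i in 𝓕, ∀ y, ξ i y ≤ (1 - a)⁻¹)
    (h1 : Tendsto (fun i => ∫ y, ξ i y ∂ν) 𝓕 (𝓝 1))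
    (hne : ∀ y, X y ≠ q → ∀ᶠ i in 𝓕, ξ i y = ξ₀ y)
    {Z : Y → E} (hZ : Integrable Z ν)
    (hinv : ∀ η, TailWeight ν X a η q → ∫ y, η y • Z y ∂ν = ∫ y, ξ₀ y • Z y ∂ν) :
    Tendsto (fun i => ∫ y, ξ i y • Z y ∂ν) 𝓕 (𝓝 (∫ y, ξ₀ y • Z y ∂ν)) := by
  choose! η hη' using fun i (h : Measurable (ξ i) ∧ (∀ y, 0 ≤ ξ i y) ∧ ∀ y, ξ i y ≤ (1 - a)⁻¹) =>
    h₀.exists_near hXm h.1 h.2.1 h.2.2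
  have hη : ∀ᶠ i in 𝓕, _ := (hm.and (h0.and hb)).mono hη'
  have hA : MeasurableSet (X ⁻¹' {q}) := hXm (measurableSet_singleton q)
  have hlim : Tendsto (fun i => ∫ y in (X ⁻¹' {q})ᶜ, |ξ i y - ξ₀ y| ∂ν) 𝓕 (𝓝 0) := by
    suffices h : Tendsto (fun i => ∫ y in (X ⁻¹' {q})ᶜ, |ξ i y - ξ₀ y| ∂ν) 𝓕
      (𝓝 (∫ _ in (X ⁻¹' {q})ᶜ, (0 : ℝ) ∂ν)) by simpa using h
    refine tendsto_integral_filter_of_dominated_convergence (fun _ => (1 - a)⁻¹) ?_ ?_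
      (integrable_const _) ?_
    · filter_upwards [hm] with i hi
      exact (hi.sub h₀.measurable).abs.aestronglyMeasurable
    · filter_upwards [h0, hb] with i e1 e2
      refine .of_forall fun y => ?_
      rw [Real.norm_eq_abs, abs_abs]
      exact abs_sub_le_of_nonneg_of_le (e1 y) (e2 y) (h₀.nonneg y) (h₀.le y)
    · filter_upwards [ae_restrict_mem hA.compl] with y hy
      refine tendsto_const_nhds.congr' ?_
      filter_upwards [hne y hy] with i hi
      simp [hi]
  have hL1 : Tendsto (fun i => ∫ y, |ξ i y - η i y| ∂ν) 𝓕 (𝓝 0) := by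
    have e := ((h1.sub_const 1).abs).add (hlim.const_mul 2)
    rw [sub_self, abs_zero, mul_zero, add_zero] at e
    exact squeeze_zero' (.of_forall fun i => integral_nonneg fun y => abs_nonneg _)
      (hη.mono fun i hi => hi.2) e
  have hfin := tendsto_integral_smul_of_tendsto_integral_abs (K := (1 - a)⁻¹)
    (ζ := fun i y => ξ i y - η i y)
    (by filter_upwards [hm, hη] with i e1 e2 using e1.sub e2.1.measurable)
    (by
      filter_upwards [h0, hb, hη] with i e1 e2 e3 y
      exact abs_sub_le_of_nonneg_of_le (e1 y) (e2 y) (e3.1.nonneg y) (e3.1.le y)) hL1 hZ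
  have := hfin.add_const (∫ y, ξ₀ y • Z y ∂ν)
  rw [zero_add] at this
  refine this.congr' ?_
  have hbdd : ∀ f : Y → ℝ, Measurable f → (∀ y, 0 ≤ f y) → (∀ y, f y ≤ (1 - a)⁻¹) →
      Integrable (fun y => f y • Z y) ν := fun f e1 e2 e3 =>
    hZ.bdd_smul (1 - a)⁻¹ e1.aestronglyMeasurable (.of_forall fun y => by
      rw [Real.norm_of_nonneg (e2 y)]
      exact e3 y)
  filter_upwards [hm, h0, hb, hη] with i e1 e2 e3 e4
  simp only [sub_smul]
  rw [integral_sub (hbdd _ e1 e2 e3) (hbdd _ e4.1.measurable e4.1.nonneg e4.1.le), hinv _ e4.1,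
    sub_add_cancel]

end WeightConvergence

/-! ### The envelope theorem for CVaR along a smooth family. -/

section Gradient

variable {Y : Type*} [MeasurableSpace Y]
  {E : Type*} [NormedAddCommGroup E] [InnerProductSpace ℝ E] [CompleteSpace E]
  {ν : E → Measure Y} {X ρ : E → Y → ℝ} {D g : Y → E} {G : Y → ℝ} {K : ℝ} {θ : E} {a : ℝ}

/-- Near `θ`, the measures `ν x` have densities `ρ x` with respect to `ν θ`, and these densities
and the random variables `X x` are differentiable at `θ` with integrable Lipschitz bounds. -/
structure SmoothFamily (ν : E → Measure Y) (X ρ : E → Y → ℝ) (D g : Y → E) (G : Y → ℝ) (K : ℝ)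
    (θ : E) : Prop where
  isProbabilityMeasure : ∀ᶠ x in 𝓝 θ, IsProbabilityMeasure (ν x)
  tilt : ∀ᶠ x in 𝓝 θ, DensityTilt (ν θ) (ν x) (ρ x) (K * ‖x - θ‖)
  measurable : ∀ᶠ x in 𝓝 θ, Measurable (X x)
  integrable : Integrable (X θ) (ν θ)
  integrable_bound : Integrable G (ν θ)
  abs_sub_le : ∀ᶠ x in 𝓝 θ, ∀ y, |X x y - X θ y| ≤ G y * ‖x - θ‖
  density_gradient : ∀ y, HasGradientAt (fun x => ρ x y) (D y) θ
  gradient : ∀ y, HasGradientAt (fun x => X x y) (g y) θ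
  aestronglyMeasurable_density_gradient : AEStronglyMeasurable D (ν θ)
  aestronglyMeasurable_gradient : AEStronglyMeasurable g (ν θ)
  K_nonneg : 0 ≤ K
  G_nonneg : ∀ y, 0 ≤ G y

lemma HasGradientAt.norm_le_of_lip {f : E → ℝ} {f' : E} {c : ℝ} (hf : HasGradientAt f f' θ)
    (hc : 0 ≤ c) (h : ∀ᶠ x in 𝓝 θ, |f x - f θ| ≤ c * ‖x - θ‖) : ‖f'‖ ≤ c := by
  rw [← (InnerProductSpace.toDual ℝ E).norm_map f']
  exact hf.hasFDerivAt.le_of_lip' hc h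

namespace SmoothFamily

lemma isProbabilityMeasure_self (h : SmoothFamily ν X ρ D g G K θ) :
    IsProbabilityMeasure (ν θ) := h.isProbabilityMeasure.self_of_nhds

lemma measurable_self (h : SmoothFamily ν X ρ D g G K θ) : Measurable (X θ) :=
  h.measurable.self_of_nhds

lemma density_self (h : SmoothFamily ν X ρ D g G K θ) (y : Y) : ρ θ y = 1 := by
  have := h.tilt.self_of_nhds.abs_sub_one_le y
  rw [sub_self, norm_zero, mul_zero] at this
  exact sub_eq_zero.1 (abs_eq_zero.1 (le_antisymm this (abs_nonneg _)))

lemma norm_density_gradient_le (h : SmoothFamily ν X ρ D g G K θ) (y : Y) : ‖D y‖ ≤ K := by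
  refine (h.density_gradient y).norm_le_of_lip h.K_nonneg ?_
  filter_upwards [h.tilt] with x hx
  rw [h.density_self]
  exact hx.abs_sub_one_le y

lemma norm_gradient_le (h : SmoothFamily ν X ρ D g G K θ) (y : Y) : ‖g y‖ ≤ G y := by
  refine (h.gradient y).norm_le_of_lip (h.G_nonneg y) ?_
  filter_upwards [h.abs_sub_le] with x hx using hx y

lemma integrable_gradient (h : SmoothFamily ν X ρ D g G K θ) : Integrable g (ν θ) :=
  h.integrable_bound.mono' h.aestronglyMeasurable_gradient (.of_forall h.norm_gradient_le)

lemma integrable_smul_density_gradient (h : SmoothFamily ν X ρ D g G K θ) {f : Y → ℝ}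
    (hf : Integrable f (ν θ)) : Integrable (fun y => f y • D y) (ν θ) :=
  hf.smul_bdd K h.aestronglyMeasurable_density_gradient
    (.of_forall h.norm_density_gradient_le)

lemma eventually_integrable (h : SmoothFamily ν X ρ D g G K θ) :
    ∀ᶠ x in 𝓝 θ, Integrable (X x) (ν θ) := by
  filter_upwards [h.measurable, h.abs_sub_le] with x h1 h2
  have : Integrable (fun y => X x y - X θ y) (ν θ) :=
    (h.integrable_bound.mul_const ‖x - θ‖).mono'
      (h1.sub h.measurable_self).aestronglyMeasurable (.of_forall h2)
  refine (this.add h.integrable).congr (.of_forall fun y => ?_)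
  simp

lemma tendsto_density (h : SmoothFamily ν X ρ D g G K θ) (y : Y) :
    Tendsto (fun x => ρ x y) (𝓝 θ) (𝓝 1) := by
  simpa only [ContinuousAt, h.density_self] using
    (h.density_gradient y).hasFDerivAt.continuousAt

lemma tendsto_excessObjective (h : SmoothFamily ν X ρ D g G K θ) (r : ℝ) :
    Tendsto (fun x => excessObjective (ν x) (X x) a r) (𝓝 θ)
      (𝓝 (excessObjective (ν θ) (X θ) a r)) := by
  have := h.isProbabilityMeasure_self
  suffices hI : Tendsto (fun x => ∫ y, ρ x y * max (X x y - r) 0 ∂ν θ) (𝓝 θ)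
      (𝓝 (∫ y, 1 * max (X θ y - r) 0 ∂ν θ)) by
    simp only [one_mul] at hI
    refine ((hI.const_mul (1 - a)⁻¹).const_add r).congr' ?_
    filter_upwards [h.tilt] with x hx
    rw [excessObjective, hx.integral_eq]
  refine tendsto_integral_filter_of_dominated_convergence
    (fun y => (1 + K) * (|X θ y| + G y + |r|)) ?_ ?_ ?_ (.of_forall fun y => ?_)
  · filter_upwards [h.tilt, h.measurable] with x h1 h2
    exact (h1.measurable.mul ((h2.sub_const r).max measurable_const)).aestronglyMeasurable
  · filter_upwards [h.tilt, h.abs_sub_le, Metric.ball_mem_nhds θ one_pos] with x h1 h2 h3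
    rw [mem_ball_iff_norm] at h3
    refine .of_forall fun y => ?_
    rw [Real.norm_of_nonneg (mul_nonneg (h1.nonneg y) (le_max_right _ _))]
    have h4 : |X x y - X θ y| ≤ G y :=
      (h2 y).trans (mul_le_of_le_one_right (h.G_nonneg y) h3.le)
    have h5 : ρ x y ≤ 1 + K := (h1.le y).trans
      (add_le_add_right (mul_le_of_le_one_right h.K_nonneg h3.le) _)
    refine mul_le_mul h5 (max_le ?_ ?_) (le_max_right _ _) (by linarith [h.K_nonneg])
    · linarith [le_abs_self (X x y - X θ y), le_abs_self (X θ y), neg_abs_le r]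
    · have := h.G_nonneg y
      positivity
  · exact ((h.integrable.abs.add h.integrable_bound).add (integrable_const _)).const_mul _
  · exact (h.tendsto_density y).mul
      (((h.gradient y).hasFDerivAt.continuousAt.sub_const r).max tendsto_const_nhds)

lemma eventually_exists_tailWeight (h : SmoothFamily ν X ρ D g G K θ) (ha0 : 0 < a)
    (ha1 : a < 1) :
    ∃ ξ : E → Y → ℝ, ∀ᶠ x in 𝓝 θ,
      TailWeight (ν x) (X x) a (ξ x) (VaR ((ν x).map (X x)) a) := by
  choose! ξ hξ using fun x (hx : IsProbabilityMeasure (ν x) ∧ Measurable (X x)) =>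
    have := hx.1
    exists_tailWeight_VaR (ν := ν x) hx.2 ha0 ha1
  exact ⟨ξ, (h.isProbabilityMeasure.and h.measurable).mono hξ⟩

/-- Quantiles are continuous in the parameter where they are unique. -/
lemma tendsto_VaR (h : SmoothFamily ν X ρ D g G K θ) (ha0 : 0 < a) (ha1 : a < 1)
    (hq : ∀ x x', IsQuantile ((ν θ).map (X θ)) a x → IsQuantile ((ν θ).map (X θ)) a x' → x = x') :
    Tendsto (fun x => VaR ((ν x).map (X x)) a) (𝓝 θ) (𝓝 (VaR ((ν θ).map (X θ)) a)) := by
  have := h.isProbabilityMeasure_self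
  obtain ⟨ξ, hξ⟩ := h.eventually_exists_tailWeight ha0 ha1
  have hξ₀ := hξ.self_of_nhds
  set q := VaR ((ν θ).map (X θ)) a
  -- Only pointwise convergence of the objectives is needed. If the minimiser at `x` lay beyond `q ±
  -- ε`, convexity would bound the value at `q ± ε` by the value at `q`, against this strict
  -- inequality.
  have key : ∀ r, r ≠ q → ∀ᶠ x in 𝓝 θ,
      excessObjective (ν x) (X x) a q < excessObjective (ν x) (X x) a r := fun r hr =>
    (h.tendsto_excessObjective q).eventually_lt (h.tendsto_excessObjective r)
      (hξ₀.excessObjective_lt h.measurable_self h.integrable ha1 hq hr)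
  rw [Metric.tendsto_nhds]
  intro ε hε
  filter_upwards [hξ, h.eventually_integrable, h.isProbabilityMeasure, h.tilt,
    key (q + ε) (by linarith), key (q - ε) (by linarith)] with x h1 h2 h3 h4 h5 h6
  have hmin := h1.excessObjective_le (h4.integrable h2) q
  have hconv := excessObjective_convex (h4.integrable h2) ha1
  rw [Real.dist_eq, abs_sub_lt_iff]
  constructor
  · by_contra! hc
    have := hconv.le_max_of_mem_Icc (mem_univ q) (mem_univ _)
      (show q + ε ∈ Icc q (VaR ((ν x).map (X x)) a) from ⟨by linarith, by linarith⟩)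
    rw [max_eq_left hmin] at this
    exact this.not_gt h5
  · by_contra! hc
    have := hconv.le_max_of_mem_Icc (mem_univ _) (mem_univ q)
      (show q - ε ∈ Icc (VaR ((ν x).map (X x)) a) q from ⟨by linarith, by linarith⟩)
    rw [max_eq_right hmin] at this
    exact this.not_gt h6

/-- The integrand of the Lagrangian is differentiable in mean. -/
lemma isLittleO_integral_abs_remainder (h : SmoothFamily ν X ρ D g G K θ) {q : ℝ} {l : E → ℝ}
    (hl : Tendsto l (𝓝 θ) (𝓝 q)) :
    (fun x => ∫ y, |ρ x y * (X x y - l x) - (X θ y - l x) -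
      ⟪(X θ y - q) • D y + g y, x - θ⟫| ∂ν θ) =o[𝓝 θ] fun x => ‖x - θ‖ := by
  have := h.isProbabilityMeasure_self
  set R : E → Y → ℝ := fun x y => ρ x y * (X x y - l x) - (X θ y - l x) -
      ⟪(X θ y - q) • D y + g y, x - θ⟫ with hR
  -- Each summand is visibly of smaller order: a first-order remainder times a bounded factor, or a
  -- product of a first-order and a vanishing factor.
  have hRe : ∀ x y, R x y = (ρ x y - 1 - ⟪D y, x - θ⟫) * (X θ y - q) + (ρ x y - 1) * (q - l x) +
      ρ x y * (X x y - X θ y - ⟪g y, x - θ⟫) + (ρ x y - 1) * ⟪g y, x - θ⟫ := fun x y => by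
    simp only [hR, inner_add_left, real_inner_smul_left]
    ring
  have hD := h.norm_density_gradient_le
  rw [isLittleO_iff_tendsto fun x hx => by
    rw [norm_eq_zero, sub_eq_zero] at hx
    simp [hx, h.density_self]]
  simp only [← integral_div]
  suffices hI : Tendsto (fun x => ∫ y, |R x y| / ‖x - θ‖ ∂ν θ) (𝓝 θ) (𝓝 (∫ _, 0 ∂ν θ)) by
    simpa using hI
  refine tendsto_integral_filter_of_dominated_convergence
    (fun y => K * (|X θ y| + |q| + 1) + (1 + K) * G y + ((|X θ y| + |q|) * K + G y)) ?_ ?_ ?_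
    (.of_forall fun y => ?_)
  · filter_upwards [h.tilt, h.measurable] with x h1 h2
    have h3 : AEStronglyMeasurable (fun y => ⟪(X θ y - q) • D y + g y, x - θ⟫) (ν θ) :=
      (((h.measurable_self.sub_const q).aestronglyMeasurable.smul
        h.aestronglyMeasurable_density_gradient).add
          h.aestronglyMeasurable_gradient).inner aestronglyMeasurable_const
    have h4 : AEStronglyMeasurable (R x) (ν θ) :=
      ((h1.measurable.mul (h2.sub_const _)).sub
        (h.measurable_self.sub_const _)).aestronglyMeasurable.sub h3
    exact (h4.norm.aemeasurable.div_const _).aestronglyMeasurable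
  · filter_upwards [h.tilt, h.abs_sub_le, Metric.ball_mem_nhds θ one_pos,
      hl.eventually (Metric.ball_mem_nhds q one_pos)] with x h1 h2 h3 h4
    rw [mem_ball_iff_norm] at h3
    rw [Real.dist_eq] at h4
    refine .of_forall fun y => ?_
    have hGy := h.G_nonneg y
    have hK := h.K_nonneg
    rw [Real.norm_eq_abs, abs_div, abs_abs, abs_norm]
    refine div_le_of_le_mul₀ (norm_nonneg _) (by positivity) ?_
    set t := ‖x - θ‖
    have ht : 0 ≤ t := norm_nonneg _
    have h5 : |ρ x y - 1| ≤ K * t := h1.abs_sub_one_le y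
    have h6 : ρ x y ≤ 1 + K := (h1.le y).trans
      (add_le_add_right (mul_le_of_le_one_right hK h3.le) _)
    have h7 : |X θ y - l x| ≤ |X θ y| + |q| + 1 := by
      have e1 := abs_sub (X θ y) (l x)
      have e2 : |l x| ≤ |l x - q| + |q| := by
        simpa using abs_add_le (l x - q) q
      linarith
    have h8 : |⟪(X θ y - q) • D y + g y, x - θ⟫| ≤ ((|X θ y| + |q|) * K + G y) * t := by
      refine (abs_real_inner_le_norm _ _).trans (mul_le_mul_of_nonneg_right ?_ ht)
      refine (norm_add_le _ _).trans (add_le_add ?_ (h.norm_gradient_le y))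
      rw [norm_smul]
      exact mul_le_mul (abs_sub _ _) (hD y) (norm_nonneg _) (by positivity)
    have e : R x y = ((ρ x y - 1) * (X θ y - l x) + ρ x y * (X x y - X θ y)) -
      ⟪(X θ y - q) • D y + g y, x - θ⟫ := by
      simp only [hR]
      ring
    have h9 : |(ρ x y - 1) * (X θ y - l x)| ≤ (K * t) * (|X θ y| + |q| + 1) := by
      rw [abs_mul]
      exact mul_le_mul h5 h7 (abs_nonneg _) (by positivity)
    have h10 : |ρ x y * (X x y - X θ y)| ≤ (1 + K) * (G y * t) := by
      rw [abs_mul, abs_of_nonneg (h1.nonneg y)]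
      exact mul_le_mul h6 (h2 y) (abs_nonneg _) (by positivity)
    rw [e]
    refine (abs_sub _ _).trans ((add_le_add ((abs_add_le _ _).trans (add_le_add h9 h10)) h8).trans
      (le_of_eq ?_))
    ring
  · exact ((((h.integrable.abs.add (integrable_const _)).add (integrable_const _)).const_mul _).add
      (h.integrable_bound.const_mul _)).add
        (((h.integrable.abs.add (integrable_const _)).mul_const _).add h.integrable_bound)
  · have hO : (fun x => R x y) =o[𝓝 θ] fun x => ‖x - θ‖ := by
      rw [isLittleO_norm_right]
      simp only [hRe]
      have e1 : (fun x => ρ x y - 1 - ⟪D y, x - θ⟫) =o[𝓝 θ] fun x => x - θ := by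
        simpa only [h.density_self] using
          hasGradientAt_iff_isLittleO.1 (h.density_gradient y)
      have e2 : (fun x => X x y - X θ y - ⟪g y, x - θ⟫) =o[𝓝 θ] fun x => x - θ :=
        hasGradientAt_iff_isLittleO.1 (h.gradient y)
      have e3 : (fun x => ρ x y - 1) =O[𝓝 θ] fun x => x - θ :=
        IsBigO.of_bound K (by
          filter_upwards [h.tilt] with x hx using hx.abs_sub_one_le y)
      have e4 : (fun x => ρ x y - 1) =o[𝓝 θ] fun _ => (1 : ℝ) := by
        rw [isLittleO_one_iff]
        simpa using (h.tendsto_density y).sub_const 1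
      have e5 : (fun x => q - l x) =o[𝓝 θ] fun _ => (1 : ℝ) := by
        rw [isLittleO_one_iff]
        simpa using hl.const_sub q
      have e6 : (fun x => ρ x y) =O[𝓝 θ] fun _ => (1 : ℝ) := (h.tendsto_density y).isBigO_one ℝ
      have e7 : (fun x => ⟪g y, x - θ⟫) =O[𝓝 θ] fun x => x - θ :=
        IsBigO.of_bound ‖g y‖ (.of_forall fun x => abs_real_inner_le_norm _ _)
      have f1 : (fun x => (ρ x y - 1 - ⟪D y, x - θ⟫) * (X θ y - q)) =o[𝓝 θ] fun x => x - θ := by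
        simpa only [mul_comm] using e1.const_mul_left (X θ y - q)
      have f2 : (fun x => (ρ x y - 1) * (q - l x)) =o[𝓝 θ] fun x => x - θ := by
        simpa only [mul_one, isLittleO_norm_right] using e3.norm_right.mul_isLittleO e5
      have f3 : (fun x => ρ x y * (X x y - X θ y - ⟪g y, x - θ⟫)) =o[𝓝 θ] fun x => x - θ := by
        simpa only [one_mul, isLittleO_norm_right] using e6.mul_isLittleO e2.norm_right
      have f4 : (fun x => (ρ x y - 1) * ⟪g y, x - θ⟫) =o[𝓝 θ] fun x => x - θ := by
        simpa only [one_mul, isLittleO_norm_right] using e4.mul_isBigO e7.norm_right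
      exact ((f1.add f2).add f3).add f4
    have := hO.tendsto_div_nhds_zero.abs
    simpa only [abs_div, abs_norm, abs_zero] using this

/-- The envelope theorem for `CVaR`. -/
theorem hasGradientAt_CVaR (h : SmoothFamily ν X ρ D g G K θ) (ha0 : 0 < a) (ha1 : a < 1)
    (hq : ∀ x x', IsQuantile ((ν θ).map (X θ)) a x → IsQuantile ((ν θ).map (X θ)) a x' → x = x')
    (hinv : ∀ ξ l ξ' l', IsSaddlePoint (ν θ) (X θ) a ξ l → IsSaddlePoint (ν θ) (X θ) a ξ' l' →
      ∫ y, ξ y • g y ∂ν θ = ∫ y, ξ' y • g y ∂ν θ)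
    {ξ : Y → ℝ} {l : ℝ} (hs : IsSaddlePoint (ν θ) (X θ) a ξ l) :
    HasGradientAt (fun x => CVaR ((ν x).map (X x)) a)
      ((1 - a)⁻¹ • ∫ y, max (X θ y - l) 0 • D y ∂ν θ + ∫ y, ξ y • g y ∂ν θ) θ := by
  have := h.isProbabilityMeasure_self
  have hXm := h.measurable_self
  have hb : 0 ≤ (1 - a)⁻¹ := (inv_pos.2 (sub_pos.2 ha1)).le
  obtain ⟨ζ, hζ⟩ := h.eventually_exists_tailWeight ha0 ha1
  have hζ₀ := hζ.self_of_nhds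
  set v : E → ℝ := fun x => VaR ((ν x).map (X x)) a
  have hv : Tendsto v (𝓝 θ) (𝓝 (v θ)) := h.tendsto_VaR ha0 ha1 hq
  set q := v θ
  have hlq : l = q := hq _ _ (hs.isQuantile hXm h.integrable ha1)
    ((hζ₀.isSaddlePoint h.integrable).isQuantile hXm h.integrable ha1)
  set Z : Y → E := fun y => (X θ y - q) • D y + g y with hZ
  have hXq : Integrable (fun y => X θ y - q) (ν θ) := h.integrable.sub (integrable_const q)
  have hZi : Integrable Z (ν θ) := (h.integrable_smul_density_gradient hXq).add h.integrable_gradient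
  -- Slackness turns `η (X θ - q)` into `(1-a)⁻¹ (X θ - q)₊`, which no longer involves `η`; `hinv`
  -- handles the `g` part.
  have hsmul : ∀ η, TailWeight (ν θ) (X θ) a η q → ∫ y, η y • Z y ∂ν θ =
      (1 - a)⁻¹ • ∫ y, max (X θ y - l) 0 • D y ∂ν θ + ∫ y, ξ y • g y ∂ν θ := by
    intro η hη
    have hi1 : Integrable (fun y => ((1 - a)⁻¹ * max (X θ y - q) 0) • D y) (ν θ) :=
      h.integrable_smul_density_gradient ((integrable_excess h.integrable q).const_mul _)
    have hi2 : Integrable (fun y => η y • g y) (ν θ) :=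
      h.integrable_gradient.bdd_smul (1 - a)⁻¹ hη.measurable.aestronglyMeasurable
        (.of_forall fun y => by
          rw [Real.norm_of_nonneg (hη.nonneg y)]
          exact hη.le y)
    rw [← hinv _ _ _ _ (hη.isSaddlePoint h.integrable) hs, hlq, ← integral_smul]
    simp only [smul_smul]
    rw [← integral_add hi1 hi2]
    congr with y
    rw [hZ, smul_add, smul_smul, mul_comm, hη.mul_eq]
  rw [← hsmul _ hζ₀]
  have hrem₁ := h.isLittleO_integral_abs_remainder hv
  have hrem₂ := h.isLittleO_integral_abs_remainder (tendsto_const_nhds (x := q))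
  -- `ζ x` is normalised under `ν x`, not under `ν θ`; the discrepancy is at most `(1-a)⁻¹ K ‖x -
  -- θ‖`.
  have hone : Tendsto (fun x => ∫ y, ζ x y ∂ν θ) (𝓝 θ) (𝓝 1) := by
    have hδ : Tendsto (fun x => (1 - a)⁻¹ * (K * ‖x - θ‖)) (𝓝 θ) (𝓝 0) := by
      have : Tendsto (fun x => (1 - a)⁻¹ * (K * ‖x - θ‖)) (𝓝 θ)
        (𝓝 ((1 - a)⁻¹ * (K * ‖θ - θ‖))) := Continuous.tendsto (by fun_prop) θ
      simpa using this
    rw [tendsto_iff_norm_sub_tendsto_zero]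
    refine squeeze_zero' (.of_forall fun x => norm_nonneg _) ?_ hδ
    filter_upwards [hζ, h.tilt] with x h1 h2
    have hi : Integrable (ζ x) (ν θ) := (h1.boxConstraint _).integrable
    have e : ∫ y, ζ x y ∂ν θ - 1 = ∫ y, (ζ x y - ρ x y * ζ x y) ∂ν θ := by
      rw [integral_sub hi (h2.integrable_mul hi), ← h2.integral_eq, h1.integral_eq_one]
    rw [e]
    refine (norm_integral_le_of_norm_le_const (.of_forall fun y => ?_)).trans_eq (by simp; rfl)
    rw [← one_sub_mul, norm_mul, mul_comm, norm_sub_rev, Real.norm_of_nonneg (h1.nonneg y)]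
    exact mul_le_mul (h1.le y) (h2.abs_sub_one_le y) (norm_nonneg _) hb
  have hconv : Tendsto (fun x => ∫ y, ζ x y • Z y ∂ν θ) (𝓝 θ) (𝓝 (∫ y, ζ θ y • Z y ∂ν θ)) := by
    refine hζ₀.tendsto_integral_smul hXm (hζ.mono fun x hx => hx.measurable)
      (hζ.mono fun x hx => hx.nonneg) (hζ.mono fun x hx => hx.le) hone (fun y hy => ?_) hZi
      fun η hη => by rw [hsmul η hη, hsmul _ hζ₀]
    have hXc : Tendsto (fun x => X x y) (𝓝 θ) (𝓝 (X θ y)) :=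
      (h.gradient y).hasFDerivAt.continuousAt
    rcases lt_or_gt_of_ne hy with hy | hy
    · filter_upwards [hζ, hXc.eventually_lt hv hy] with x h1 h2
      rw [h1.eq_zero_of_lt y h2, hζ₀.eq_zero_of_lt y hy]
    · filter_upwards [hζ, hv.eventually_lt hXc hy] with x h1 h2
      rw [h1.eq_of_lt y h2, hζ₀.eq_of_lt y hy]
  have hconv' : (fun x => ‖∫ y, ζ x y • Z y ∂ν θ - ∫ y, ζ θ y • Z y ∂ν θ‖ * ‖x - θ‖) =o[𝓝 θ]
      fun x => ‖x - θ‖ := by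
    have : (fun x => ‖∫ y, ζ x y • Z y ∂ν θ - ∫ y, ζ θ y • Z y ∂ν θ‖) =o[𝓝 θ]
        fun _ => (1 : ℝ) := by
      rw [isLittleO_one_iff]
      exact tendsto_iff_norm_sub_tendsto_zero.1 hconv
    simpa using this.mul_isBigO (isBigO_refl (fun x => ‖x - θ‖) (𝓝 θ))
  rw [hasGradientAt_iff_isLittleO, ← isLittleO_norm_right]
  refine IsBigO.trans_isLittleO (IsBigO.of_bound 1 ?_)
    (((hrem₁.const_mul_left (1 - a)⁻¹).add (hrem₂.const_mul_left (1 - a)⁻¹)).add hconv')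
  filter_upwards [hζ, h.tilt, h.eventually_integrable, h.measurable, h.isProbabilityMeasure]
    with x h1 h2 h3 h4 h5
  -- The lower bound pairs the fixed weight `ζ θ` with the moving level `v x`; the upper bound pairs
  -- the moving weight `ζ x` with the fixed level `q`. Only the latter needs `hconv`.
  have hlow := h2.le_CVaR_sub hXm h.integrable h4 h3 ha0 ha1 hζ₀ h1
  have hupp := h2.CVaR_sub_le hXm h.integrable h4 h3 ha0 ha1 hζ₀ h1
  have hZin : Integrable (fun y => ⟪Z y, x - θ⟫) (ν θ) := hZi.inner_const _
  have hRi : ∀ r, Integrable (fun y => ρ x y * (X x y - r) - (X θ y - r) - ⟪Z y, x - θ⟫) (ν θ) :=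
    fun r => ((h2.integrable_mul (h3.sub (integrable_const r))).sub
      (h.integrable.sub (integrable_const r))).sub hZin
  have hint : ∀ η r, BoxConstraint (ν θ) a η → (∀ y, 0 ≤ η y ∧ η y ≤ (1 - a)⁻¹) →
      |∫ y, (ρ x y * (X x y - r) - (X θ y - r)) * η y ∂ν θ - ⟪∫ y, η y • Z y ∂ν θ, x - θ⟫| ≤
        (1 - a)⁻¹ * ∫ y, |ρ x y * (X x y - r) - (X θ y - r) - ⟪Z y, x - θ⟫| ∂ν θ := by
    intro η r hη hη'
    have hηZ : Integrable (fun y => η y • Z y) (ν θ) :=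
      hZi.bdd_smul (1 - a)⁻¹ hη.1.aestronglyMeasurable (.of_forall fun y => by
        rw [Real.norm_of_nonneg (hη' y).1]
        exact (hη' y).2)
    have e1 : ⟪∫ y, η y • Z y ∂ν θ, x - θ⟫ = ∫ y, ⟪Z y, x - θ⟫ * η y ∂ν θ := by
      rw [real_inner_comm, ← integral_inner hηZ]
      congr with y
      rw [real_inner_smul_right, real_inner_comm, mul_comm]
    have e2 : ∀ y, (ρ x y * (X x y - r) - (X θ y - r)) * η y =
        (ρ x y * (X x y - r) - (X θ y - r) - ⟪Z y, x - θ⟫) * η y + ⟪Z y, x - θ⟫ * η y := fun y => by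
      ring
    simp only [e2]
    rw [integral_add (hη.integrable_mul (hRi r)) (hη.integrable_mul hZin), e1, add_sub_cancel_right,
      ← integral_const_mul]
    refine abs_integral_le_integral_abs.trans (integral_mono (hη.integrable_mul (hRi r)).abs
      ((hRi r).abs.const_mul _) fun y => ?_)
    simp only [abs_mul, abs_of_nonneg (hη' y).1]
    rw [mul_comm]
    exact mul_le_mul_of_nonneg_right (hη' y).2 (abs_nonneg _)
  have b1 := abs_le.1 (hint (ζ θ) (v x) (hζ₀.boxConstraint _) fun y => ⟨hζ₀.nonneg y, hζ₀.le y⟩)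
  have b2 := abs_le.1 (hint (ζ x) q (h1.boxConstraint _) fun y => ⟨h1.nonneg y, h1.le y⟩)
  have b3 : ⟪∫ y, ζ x y • Z y ∂ν θ, x - θ⟫ - ⟪∫ y, ζ θ y • Z y ∂ν θ, x - θ⟫ ≤
      ‖∫ y, ζ x y • Z y ∂ν θ - ∫ y, ζ θ y • Z y ∂ν θ‖ * ‖x - θ‖ := by
    rw [← inner_sub_left]
    exact real_inner_le_norm _ _
  have p1 : 0 ≤ (1 - a)⁻¹ * ∫ y, |ρ x y * (X x y - v x) - (X θ y - v x) - ⟪Z y, x - θ⟫| ∂ν θ :=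
    mul_nonneg hb (integral_nonneg fun y => abs_nonneg _)
  have p2 : 0 ≤ (1 - a)⁻¹ * ∫ y, |ρ x y * (X x y - q) - (X θ y - q) - ⟪Z y, x - θ⟫| ∂ν θ :=
    mul_nonneg hb (integral_nonneg fun y => abs_nonneg _)
  have p3 : 0 ≤ ‖∫ y, ζ x y • Z y ∂ν θ - ∫ y, ζ θ y • Z y ∂ν θ‖ * ‖x - θ‖ := by positivity
  rw [one_mul, Real.norm_eq_abs, Real.norm_of_nonneg (add_nonneg (add_nonneg p1 p2) p3), abs_le]
  constructor <;> linarith [b1.1, b1.2, b2.1, b2.2]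

end SmoothFamily

end Gradient

/-! ### Measurability of gradients and reweighted image laws. -/

section MeasurableGradient

variable {Y : Type*} [MeasurableSpace Y]
  {E : Type*} [NormedAddCommGroup E] [InnerProductSpace ℝ E]

lemma stronglyMeasurable_of_hasGradientAt [FiniteDimensional ℝ E] [CompleteSpace E] {f : E → Y → ℝ} {g : Y → E} {θ : E}
    (hf : ∀ᶠ x in 𝓝 θ, Measurable (f x)) (hg : ∀ y, HasGradientAt (fun x => f x y) (g y) θ) :
    StronglyMeasurable g := by
  have hinner : ∀ v, Measurable fun y => ⟪v, g y⟫ := by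
    intro v
    have hc : Tendsto (fun n : ℕ => (n : ℝ)) atTop atTop := tendsto_natCast_atTop_atTop
    have hlim : Tendsto (fun n : ℕ => θ + (n : ℝ)⁻¹ • v) atTop (𝓝 θ) := by
      simpa using (hc.inv_tendsto_atTop.smul_const v).const_add θ
    -- The difference quotients along `v / n` are known to be measurable only near `θ`, so the
    -- sequence is started at `N`.
    obtain ⟨N, hN⟩ := eventually_atTop.1 (hlim.eventually hf)
    have hc' : Tendsto (fun n : ℕ => ((n + N : ℕ) : ℝ)) atTop atTop :=
      hc.comp (tendsto_add_atTop_nat N)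
    refine measurable_of_tendsto_metrizable (f := fun (n : ℕ) y =>
      ((n + N : ℕ) : ℝ) * (f (θ + ((n + N : ℕ) : ℝ)⁻¹ • v) y - f θ y)) (fun n => ?_)
      (tendsto_pi_nhds.2 fun y => ?_)
    · exact ((hN _ (Nat.le_add_left N n)).sub hf.self_of_nhds).const_mul _
    · have := (hg y).hasFDerivAt.lim v (tendsto_norm_atTop_atTop.comp hc')
      simpa [real_inner_comm] using this
  have e : g = fun y => ∑ i, ⟪stdOrthonormalBasis ℝ E i, g y⟫ • stdOrthonormalBasis ℝ E i :=
    funext fun y => ((stdOrthonormalBasis ℝ E).sum_repr' (g y)).symm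
  rw [e]
  exact Finset.stronglyMeasurable_fun_sum _ fun i _ =>
    (hinner _).stronglyMeasurable.smul_const _

/-- Weights inducing the same reweighted law of `f` agree on functions of `f`. -/
lemma integral_smul_comp_eq_of_setIntegral_eq {S : Type*} [MeasurableSpace S] {ν : Measure Y}
    {f : Y → S} (hf : Measurable f) {ξ ξ' : Y → ℝ} (hξm : Measurable ξ) (hξm' : Measurable ξ')
    (hξ : Integrable ξ ν) (hξ' : Integrable ξ' ν) (h0 : ∀ᵐ y ∂ν, 0 ≤ ξ y)
    (h0' : ∀ᵐ y ∂ν, 0 ≤ ξ' y)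
    (h : ∀ B : Set S, MeasurableSet B → ∫ y in f ⁻¹' B, ξ y ∂ν = ∫ y in f ⁻¹' B, ξ' y ∂ν)
    {g : S → E} (hg : StronglyMeasurable g) :
    ∫ y, ξ y • g (f y) ∂ν = ∫ y, ξ' y • g (f y) ∂ν := by
  -- The integral depends on the weight only through the image under `f` of the reweighted measure.
  have key : ∀ η : Y → ℝ, Measurable η → (∀ᵐ y ∂ν, 0 ≤ η y) → ∫ y, η y • g (f y) ∂ν =
      ∫ s, g s ∂((ν.withDensity fun y => ENNReal.ofReal (η y)).map f) := by
    intro η hη h0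
    rw [integral_map hf.aemeasurable hg.aestronglyMeasurable,
      integral_withDensity_eq_integral_toReal_smul hη.ennreal_ofReal
        (.of_forall fun _ => ENNReal.ofReal_lt_top)]
    refine integral_congr_ae ?_
    filter_upwards [h0] with y hy
    rw [ENNReal.toReal_ofReal hy]
  rw [key ξ hξm h0, key ξ' hξm' h0']
  congr 1
  ext B hB
  rw [Measure.map_apply hf hB, Measure.map_apply hf hB, withDensity_apply _ (hf hB),
    withDensity_apply _ (hf hB), ← ofReal_integral_eq_lintegral_ofReal hξ.restrict
      (ae_restrict_of_ae h0), ← ofReal_integral_eq_lintegral_ofReal hξ'.restrict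
      (ae_restrict_of_ae h0'), h B hB]

end MeasurableGradient

/-! ### Measurable dependence of CVaR on the state. -/

section Kernel

variable {S Y : Type*} [MeasurableSpace S] [MeasurableSpace Y]

lemma measurable_CVaR_map {κ : Kernel S Y} [IsMarkovKernel κ] {X : S → Y → ℝ}
    (hX : Measurable (Function.uncurry X)) (hi : ∀ s, Integrable (X s) (κ s)) {a : ℝ}
    (ha0 : 0 < a) (ha1 : a < 1) : Measurable fun s => CVaR ((κ s).map (X s)) a := by
  have hXs : ∀ s, Measurable (X s) := fun s => hX.comp measurable_prodMk_left
  have hq : Measurable fun s => VaR ((κ s).map (X s)) a := by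
    refine measurable_of_Iic fun x => ?_
    have e : (fun s => VaR ((κ s).map (X s)) a) ⁻¹' Iic x =
        {s | a ≤ (κ s (Prod.mk s ⁻¹' (Function.uncurry X ⁻¹' Iic x))).toReal} := by
      ext s
      have := Measure.isProbabilityMeasure_map (μ := κ s) (hXs s).aemeasurable
      simp only [mem_preimage, mem_Iic, VaR_le_iff ha0 ha1, mem_ofPred_eq]
      rw [map_measureReal_apply (hXs s) measurableSet_Iic]
      rfl
    rw [e]
    exact measurableSet_le measurable_const
      (Kernel.measurable_kernel_prodMk_left (hX measurableSet_Iic)).ennreal_toReal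
  have e : (fun s => CVaR ((κ s).map (X s)) a) = fun s => VaR ((κ s).map (X s)) a +
      (1 - a)⁻¹ * ∫ y, max (X s y - VaR ((κ s).map (X s)) a) 0 ∂κ s := by
    funext s
    obtain ⟨ξ, hξ⟩ := exists_tailWeight_VaR (ν := κ s) (hXs s) ha0 ha1
    exact hξ.CVaR_eq (hXs s) (hi s) ha0 ha1
  rw [e]
  refine hq.add (Measurable.const_mul ?_ _)
  have hm : Measurable (Function.uncurry fun s y => max (X s y - VaR ((κ s).map (X s)) a) 0) :=
    (hX.sub (hq.comp measurable_fst)).max measurable_const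
  exact hm.stronglyMeasurable.integral_kernel_prod_right.measurable

end Kernel

/-! ### The one-step law and change of policy. -/

section StepLaw

variable {S A : Type*} [MeasurableSpace S] [MeasurableSpace A] {μ : Measure A} [SFinite μ]
  {P : Kernel (S × A) S} [IsMarkovKernel P] {q q' : S → A → ℝ}

lemma lintegral_stepLaw (hq : Measurable fun z : S × A => q z.1 z.2) (s : S)
    {f : A × S → ENNReal} (hf : Measurable f) :
    ∫⁻ y, f y ∂(stepLaw μ P q s) =
      ∫⁻ a, ENNReal.ofReal (q s a) * ∫⁻ s', f (a, s') ∂(P (s, a)) ∂μ := by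
  have hq' : Measurable (Function.uncurry fun s a => ENNReal.ofReal (q s a)) := hq.ennreal_ofReal
  have : IsSFiniteKernel (Kernel.withDensity (Kernel.const S μ)
      (fun s a => ENNReal.ofReal (q s a))) :=
    Kernel.IsSFiniteKernel.withDensity _ fun _ _ => ENNReal.ofReal_ne_top
  rw [stepLaw, Kernel.lintegral_compProd _ _ _ hf, Kernel.lintegral_withDensity _ hq']
  · rfl
  · exact Measurable.lintegral_kernel_prod_right' (κ := P.comap (Prod.mk s) measurable_prodMk_left)
      hf

lemma isMarkovKernel_stepLaw (hq : Measurable fun z : S × A => q z.1 z.2)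
    (hq1 : ∀ s, ∫⁻ a, ENNReal.ofReal (q s a) ∂μ = 1) : IsMarkovKernel (stepLaw μ P q) := by
  refine ⟨fun s => ⟨?_⟩⟩
  rw [← lintegral_one, lintegral_stepLaw hq s measurable_const]
  simp [hq1]

lemma stepLaw_eq_withDensity (hq : Measurable fun z : S × A => q z.1 z.2)
    (hq' : Measurable fun z : S × A => q' z.1 z.2) (s : S) {ρ : A → ℝ} (hρ : Measurable ρ)
    (hρ0 : ∀ a, 0 ≤ ρ a) (h : ∀ a, q' s a = ρ a * q s a) :
    stepLaw μ P q' s = (stepLaw μ P q s).withDensity fun y => ENNReal.ofReal (ρ y.1) := by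
  have hρm : Measurable fun y : A × S => ENNReal.ofReal (ρ y.1) :=
    (hρ.comp measurable_fst).ennreal_ofReal
  ext B hB
  have hB1 : Measurable (B.indicator (1 : A × S → ENNReal)) := measurable_one.indicator hB
  rw [← lintegral_indicator_one hB, ← lintegral_indicator_one hB,
    lintegral_withDensity_eq_lintegral_mul _ hρm hB1, lintegral_stepLaw hq' s hB1,
    lintegral_stepLaw hq s (hρm.mul hB1)]
  congr with a
  simp only [Pi.mul_apply]
  have hBa : Measurable fun s' => B.indicator (1 : A × S → ENNReal) (a, s') :=
    hB1.comp measurable_prodMk_left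
  rw [lintegral_const_mul _ hBa, h, ENNReal.ofReal_mul (hρ0 a)]
  ring

end StepLaw

/-! ### A Harnack inequality from a bounded score. -/

section Likelihood

variable {E : Type*} [NormedAddCommGroup E] [InnerProductSpace ℝ E] [CompleteSpace E]
  {f : E → ℝ} {U : Set E} {C : ℝ}

/-- A nonnegative continuous function with bounded logarithmic gradient satisfies a Harnack
inequality. -/
lemma mul_exp_neg_le_of_norm_gradient_log_le (hU : IsOpen U) (hf0 : ∀ x ∈ U, 0 ≤ f x)
    (hfc : ContinuousOn f U)
    (hd : ∀ x ∈ U, f x ≠ 0 → DifferentiableAt ℝ (fun x => Real.log (f x)) x)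
    (hb : ∀ x ∈ U, f x ≠ 0 → ‖gradient (fun x => Real.log (f x)) x‖ ≤ C)
    {x y : E} (hxy : segment ℝ x y ⊆ U) :
    f x * Real.exp (-(C * ‖y - x‖)) ≤ f y := by
  rcases (hf0 x (hxy (left_mem_segment ℝ x y))).eq_or_lt with hx | hx
  · rw [← hx, zero_mul]
    exact hf0 y (hxy (right_mem_segment ℝ x y))
  set γ : ℝ → E := fun t => x + t • (y - x)
  have hγc : Continuous γ := by fun_prop
  have hγU : ∀ t ∈ Icc (0 : ℝ) 1, γ t ∈ U := fun t ht => hxy (by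
    rw [segment_eq_image']
    exact ⟨t, ht, rfl⟩)
  have hfγ : ContinuousOn (fun t => f (γ t)) (Icc 0 1) := hfc.comp hγc.continuousOn hγU
  -- Since `f` might vanish further along the segment, `log f` cannot be estimated on it at once.
  -- Instead the bound is propagated by continuous induction: where it holds, `f` is positive, so
  -- `log f` is `C`-Lipschitz on a small ball and the bound extends to the right.
  set s : Set ℝ := {t | f x * Real.exp (-(C * (t * ‖y - x‖))) ≤ f (γ t)}
  have hs : IsClosed (s ∩ Icc 0 1) := by
    have : s ∩ Icc 0 1 = Icc 0 1 ∩ (fun t => f (γ t) -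
        f x * Real.exp (-(C * (t * ‖y - x‖)))) ⁻¹' Ici 0 := by
      ext t
      simp only [s, mem_inter_iff, mem_ofPred_eq, mem_preimage, mem_Ici, sub_nonneg]
      exact and_comm
    rw [this]
    exact (hfγ.sub (by fun_prop)).preimage_isClosed_of_isClosed isClosed_Icc isClosed_Ici
  have h0 : (0 : ℝ) ∈ s := by simp [s, γ]
  have hsub : Icc (0 : ℝ) 1 ⊆ s := by
    refine hs.Icc_subset_of_forall_exists_gt h0 fun t ht z hz => ?_
    have htU : γ t ∈ U := hγU t ⟨ht.2.1, ht.2.2.le⟩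
    have hft : 0 < f (γ t) := lt_of_lt_of_le (by positivity) ht.1
    have hnear : ∀ᶠ w in 𝓝 (γ t), w ∈ U ∧ 0 < f w :=
      (hU.eventually_mem htU).and
        ((hfc.continuousAt (hU.mem_nhds htU)).eventually (lt_mem_nhds hft))
    obtain ⟨ε, hε, hball⟩ := Metric.eventually_nhds_iff_ball.1 hnear
    have hγt : ∀ᶠ u in 𝓝[>] t, γ u ∈ Metric.ball (γ t) ε :=
      (hγc.tendsto t).mono_left nhdsWithin_le_nhds (Metric.ball_mem_nhds _ hε)
    obtain ⟨u, hu, hut⟩ := (hγt.and (Ioc_mem_nhdsGT hz)).exists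
    refine ⟨u, ?_, hut⟩
    have hlip := (convex_ball (γ t) ε).norm_image_sub_le_of_norm_hasFDerivWithin_le
      (f := fun w => Real.log (f w)) (C := C)
      (fun w hw => (hd w (hball w hw).1 (hball w hw).2.ne').hasGradientAt.hasFDerivAt.hasFDerivWithinAt)
      (fun w hw => by
        rw [LinearIsometryEquiv.norm_map]
        exact hb w (hball w hw).1 (hball w hw).2.ne')
      (Metric.mem_ball_self hε) hu
    have hγd : γ u - γ t = (u - t) • (y - x) := by
      simp only [γ, sub_smul]
      abel
    rw [hγd, norm_smul, Real.norm_of_nonneg (sub_nonneg.2 hut.1.le)] at hlip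
    have h1 := (abs_le.1 hlip).1
    have hfu := (hball _ hu).2
    have h2 : Real.log (f x * Real.exp (-(C * (t * ‖y - x‖)))) ≤ Real.log (f (γ t)) :=
      Real.log_le_log (by positivity) ht.1
    change f x * Real.exp (-(C * (u * ‖y - x‖))) ≤ f (γ u)
    rw [← Real.log_le_log_iff (by positivity) hfu]
    rw [Real.log_mul hx.ne' (Real.exp_pos _).ne', Real.log_exp] at h2 ⊢
    linarith
  have := hsub (right_mem_Icc.2 zero_le_one)
  simpa [s, γ] using this

end Likelihood

/-! ### Integrability and growth of the value functions. -/

section RiskToGo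

variable {S A : Type*} [MeasurableSpace S] [MeasurableSpace A] {k : ℕ}
  {c : S → A → S → ℝ} {Q : Kernel S (A × S)} {α p : Fin k → ℝ} {T : ℕ}

lemma measurable_expectedAbsCost [IsMarkovKernel Q]
    (hc : Measurable (fun z : S × A × S => c z.1 z.2.1 z.2.2)) (n : ℕ) :
    Measurable (expectedAbsCost c Q n) := by
  induction n with
  | zero => exact measurable_const
  | succ n ih =>
    have : Measurable fun z : S × A × S => ‖c z.1 z.2.1 z.2.2‖ₑ + expectedAbsCost c Q n z.2.2 :=
      hc.enorm.add (ih.comp (measurable_snd.comp measurable_snd))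
    exact Measurable.lintegral_kernel_prod_right' this

lemma expectedAbsCost_le_succ (n : ℕ) (s : S) :
    expectedAbsCost c Q n s ≤ expectedAbsCost c Q (n + 1) s := by
  induction n generalizing s with
  | zero => exact zero_le
  | succ n ih => exact lintegral_mono fun y => add_le_add_right (ih y.2) _

lemma expectedAbsCost_lt_top (hT : ∀ s, expectedAbsCost c Q T s < ⊤) {n : ℕ} (hn : n ≤ T) (s : S) :
    expectedAbsCost c Q n s < ⊤ :=
  (monotone_nat_of_le_succ (f := fun n => expectedAbsCost c Q n s)
    (fun n => expectedAbsCost_le_succ n s) hn).trans_lt (hT s)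

variable (hc : Measurable (fun z : S × A × S => c z.1 z.2.1 z.2.2))
  (hT : ∀ s, expectedAbsCost c Q T s < ⊤)
include hc hT

lemma integrable_cost {n : ℕ} (hn : n + 1 ≤ T) (s : S) :
    Integrable (fun y : A × S => c s y.1 y.2) (Q s) := by
  refine ⟨(hc.comp measurable_prodMk_left).aestronglyMeasurable, ?_⟩
  exact (lintegral_mono fun y => le_self_add).trans_lt (expectedAbsCost_lt_top hT hn s)

variable [IsMarkovKernel Q]

lemma integrable_expectedAbsCost {n : ℕ} (hn : n + 1 ≤ T) (s : S) :
    Integrable (fun y : A × S => (expectedAbsCost c Q n y.2).toReal) (Q s) := by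
  refine integrable_toReal_of_lintegral_ne_top
    ((measurable_expectedAbsCost hc n).comp measurable_snd).aemeasurable ?_
  exact ((lintegral_mono fun y => le_add_self).trans_lt (expectedAbsCost_lt_top hT hn s)).ne

lemma toReal_expectedAbsCost_succ {n : ℕ} (hn : n + 1 ≤ T) (s : S) :
    (expectedAbsCost c Q (n + 1) s).toReal =
      ∫ y, |c s y.1 y.2| ∂(Q s) + ∫ y, (expectedAbsCost c Q n y.2).toReal ∂(Q s) := by
  have hm : Measurable fun y : A × S => expectedAbsCost c Q n y.2 :=
    (measurable_expectedAbsCost hc n).comp measurable_snd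
  have h1 := integrable_cost hc hT hn s
  have e1 : ∫ y, |c s y.1 y.2| ∂(Q s) = (∫⁻ y, ‖c s y.1 y.2‖ₑ ∂(Q s)).toReal := by
    simpa using integral_norm_eq_lintegral_enorm h1.1
  have e2 : ∫ y, (expectedAbsCost c Q n y.2).toReal ∂(Q s) =
      (∫⁻ y, expectedAbsCost c Q n y.2 ∂(Q s)).toReal :=
    integral_toReal hm.aemeasurable
      (.of_forall fun y => expectedAbsCost_lt_top hT (Nat.le_of_succ_le hn) y.2)
  have e3 : ∫⁻ y, expectedAbsCost c Q n y.2 ∂(Q s) ≠ ⊤ :=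
    ((lintegral_mono fun y => le_add_self).trans_lt (expectedAbsCost_lt_top hT hn s)).ne
  rw [e1, e2, expectedAbsCost, lintegral_add_right _ hm, ENNReal.toReal_add h1.2.ne e3]

lemma integral_abs_le_toReal_expectedAbsCost {n : ℕ} (hn : n + 1 ≤ T) {V : S → ℝ} {B : ℝ}
    (hVm : Measurable V) (hV : ∀ s, |V s| ≤ B * (expectedAbsCost c Q n s).toReal) (s : S) :
    Integrable (fun y : A × S => c s y.1 y.2 + V y.2) (Q s) ∧
      ∫ y, |c s y.1 y.2 + V y.2| ∂(Q s) ≤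
        (1 + |B|) * (expectedAbsCost c Q (n + 1) s).toReal := by
  have h1 := integrable_cost hc hT hn s
  have h2 := integrable_expectedAbsCost hc hT hn s
  have h3 : Integrable (fun y : A × S => V y.2) (Q s) :=
    (h2.const_mul B).mono' (hVm.comp measurable_snd).aestronglyMeasurable
      (.of_forall fun y => hV y.2)
  refine ⟨h1.add h3, ?_⟩
  have h4 : ∫ y, |c s y.1 y.2 + V y.2| ∂(Q s) ≤
      ∫ y, |c s y.1 y.2| ∂(Q s) + B * ∫ y, (expectedAbsCost c Q n y.2).toReal ∂(Q s) := by
    rw [← integral_const_mul, ← integral_add h1.abs (h2.const_mul B)]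
    exact integral_mono (h1.add h3).abs (h1.abs.add (h2.const_mul B)) fun y =>
      (abs_add_le _ _).trans (add_le_add_right (hV y.2) _)
  have h5 : 0 ≤ ∫ y, |c s y.1 y.2| ∂(Q s) := integral_nonneg fun y => abs_nonneg _
  have h6 : 0 ≤ ∫ y, (expectedAbsCost c Q n y.2).toReal ∂(Q s) :=
    integral_nonneg fun y => ENNReal.toReal_nonneg
  rw [toReal_expectedAbsCost_succ hc hT hn]
  have h7 := mul_le_mul_of_nonneg_right (le_abs_self B) h6
  have h8 := mul_nonneg (abs_nonneg B) h5
  linarith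

/-- The value functions are measurable and dominated by the expected absolute costs. -/
lemma measurable_and_abs_riskToGo_le (hα0 : ∀ m, 0 < α m) (hα1 : ∀ m, α m < 1)
    (hp : ∀ m, 0 < p m) {n : ℕ} (hn : n ≤ T) :
    Measurable (riskToGo c Q α p n) ∧
      ∃ B, ∀ s, |riskToGo c Q α p n s| ≤ B * (expectedAbsCost c Q n s).toReal := by
  induction n with
  | zero => exact ⟨measurable_const, 0, fun s => by simp [riskToGo]⟩
  | succ n ih =>
    obtain ⟨hm, B, hB⟩ := ih (Nat.le_of_succ_le hn)
    have key := integral_abs_le_toReal_expectedAbsCost hc hT hn hm hB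
    have hX : Measurable fun z : S × A × S => c z.1 z.2.1 z.2.2 + riskToGo c Q α p n z.2.2 :=
      hc.add (hm.comp (measurable_snd.comp measurable_snd))
    have hCVaR : ∀ m, Measurable fun s =>
        CVaR ((Q s).map fun y => c s y.1 y.2 + riskToGo c Q α p n y.2) (α m) := fun m =>
      measurable_CVaR_map hX (fun s => (key s).1) (hα0 m) (hα1 m)
    have hsum : Measurable fun s => ∑ m,
        p m * CVaR ((Q s).map fun y => c s y.1 y.2 + riskToGo c Q α p n y.2) (α m) :=
      Finset.measurable_fun_sum _ fun m _ => (hCVaR m).const_mul (p m)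
    -- `(1 - α m)⁻¹` comes from `abs_CVaR_le`, and `1 + |B|` from adding the current cost to the
    -- inductive bound.
    refine ⟨hsum, ∑ m, p m * ((1 - α m)⁻¹ * (1 + |B|)), fun s => ?_⟩
    rw [riskToGo, Finset.sum_mul]
    refine (Finset.abs_sum_le_sum_abs _ _).trans (Finset.sum_le_sum fun m _ => ?_)
    rw [abs_mul, abs_of_pos (hp m), mul_assoc, mul_assoc]
    refine mul_le_mul_of_nonneg_left ?_ (hp m).le
    exact (abs_CVaR_le (hX.comp measurable_prodMk_left) (key s).1 (hα0 m) (hα1 m)).trans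
      (mul_le_mul_of_nonneg_left (key s).2 (inv_pos.2 (sub_pos.2 (hα1 m))).le)

end RiskToGo

/-! ### Backward induction: Lipschitz bounds and the one-step gradient formula. -/

section KernelFamily

variable {S A : Type*} [MeasurableSpace S] [MeasurableSpace A] {k : ℕ}
  {E : Type*} [NormedAddCommGroup E] [InnerProductSpace ℝ E] [CompleteSpace E]
  {c : S → A → S → ℝ} {Q : E → Kernel S (A × S)} {α p : Fin k → ℝ} {T : ℕ}
  {ρ : E → S → A × S → ℝ} {D : S → A × S → E} {K r : ℝ} {θ : E}

/-- Kernels with integrable costs whose densities with respect to the kernel at `θ` are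
differentiable and uniformly Lipschitz at `θ`. -/
structure SmoothKernelFamily (c : S → A → S → ℝ) (Q : E → Kernel S (A × S)) (T : ℕ)
    (ρ : E → S → A × S → ℝ) (D : S → A × S → E) (K r : ℝ) (θ : E) : Prop where
  measurable_cost : Measurable (fun z : S × A × S => c z.1 z.2.1 z.2.2)
  r_pos : 0 < r
  K_nonneg : 0 ≤ K
  isMarkovKernel : ∀ x ∈ Metric.ball θ r, IsMarkovKernel (Q x)
  finite : ∀ x ∈ Metric.ball θ r, ∀ s, expectedAbsCost c (Q x) T s < ⊤
  tilt : ∀ x ∈ Metric.ball θ r, ∀ s, DensityTilt (Q θ s) (Q x s) (ρ x s) (K * ‖x - θ‖)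
  gradient : ∀ s y, HasGradientAt (fun x => ρ x s y) (D s y) θ

namespace SmoothKernelFamily

variable (h : SmoothKernelFamily c Q T ρ D K r θ) (hα0 : ∀ m, 0 < α m) (hα1 : ∀ m, α m < 1)
  (hp : ∀ m, 0 < p m)
include h hα0 hα1 hp

/-- The value functions are Lipschitz at `θ`, with a constant proportional to the expected
absolute costs. -/
lemma abs_riskToGo_sub_le {n : ℕ} (hn : n ≤ T) :
    ∃ L, 0 ≤ L ∧ ∀ x ∈ Metric.ball θ r, ∀ s,
      |riskToGo c (Q x) α p n s - riskToGo c (Q θ) α p n s| ≤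
        L * (expectedAbsCost c (Q θ) n s).toReal * ‖x - θ‖ := by
  have hθ : θ ∈ Metric.ball θ r := Metric.mem_ball_self h.r_pos
  have hM := h.isMarkovKernel θ hθ
  induction n with
  | zero => exact ⟨0, le_rfl, fun x _ s => by simp [riskToGo]⟩
  | succ n ih =>
    obtain ⟨L, hL, hLip⟩ := ih (Nat.le_of_succ_le hn)
    obtain ⟨hm, B, hB⟩ := measurable_and_abs_riskToGo_le (α := α) (p := p) h.measurable_cost
      (h.finite θ hθ) hα0 hα1 hp (Nat.le_of_succ_le hn)
    have key := integral_abs_le_toReal_expectedAbsCost h.measurable_cost (h.finite θ hθ) hn hm hB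
    have hb : ∀ m, 0 ≤ (1 - α m)⁻¹ := fun m => (inv_pos.2 (sub_pos.2 (hα1 m))).le
    have ha : ∀ m, 0 ≤ (α m)⁻¹ := fun m => (inv_pos.2 (hα0 m)).le
    have hK := h.K_nonneg
    have hr := h.r_pos.le
    -- This is the bound of `abs_CVaR_sub_le` with `δ = K * ‖x - θ‖`. One factor `‖x - θ‖` is
    -- extracted, any further one is bounded by `r`, and both L¹ norms are replaced by multiples of
    -- the expected absolute cost.
    refine ⟨∑ m, p m * ((1 - α m)⁻¹ * (K * ((1 + |B|) + ((α m)⁻¹ + (1 - α m)⁻¹) *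
      ((1 + K * r) * ((1 + |B|) + L * r))) + (1 + K * r) * L)), ?_, fun x hx s => ?_⟩
    · refine Finset.sum_nonneg fun m _ => mul_nonneg (hp m).le ?_
      have := hb m
      have := ha m
      positivity
    have hMx := h.isMarkovKernel x hx
    obtain ⟨hmx, -⟩ := measurable_and_abs_riskToGo_le (α := α) (p := p) h.measurable_cost
      (h.finite x hx) hα0 hα1 hp (Nat.le_of_succ_le hn)
    have hR := integrable_expectedAbsCost h.measurable_cost (h.finite θ hθ) hn s
    have hcs : Measurable fun y : A × S => c s y.1 y.2 :=
      h.measurable_cost.comp measurable_prodMk_left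
    have hXm : Measurable fun y : A × S => c s y.1 y.2 + riskToGo c (Q θ) α p n y.2 :=
      hcs.add (hm.comp measurable_snd)
    have hXm' : Measurable fun y : A × S => c s y.1 y.2 + riskToGo c (Q x) α p n y.2 :=
      hcs.add (hmx.comp measurable_snd)
    have hbd : ∀ y : A × S, |(c s y.1 y.2 + riskToGo c (Q x) α p n y.2) -
        (c s y.1 y.2 + riskToGo c (Q θ) α p n y.2)| ≤
        L * ‖x - θ‖ * (expectedAbsCost c (Q θ) n y.2).toReal := fun y => by
      rw [add_sub_add_left_eq_sub]
      exact (hLip x hx y.2).trans (le_of_eq (by ring))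
    have hdi : Integrable (fun y : A × S => (c s y.1 y.2 + riskToGo c (Q x) α p n y.2) -
        (c s y.1 y.2 + riskToGo c (Q θ) α p n y.2)) (Q θ s) :=
      (hR.const_mul _).mono' (hXm'.sub hXm).aestronglyMeasurable (.of_forall hbd)
    have hXi' : Integrable (fun y : A × S => c s y.1 y.2 + riskToGo c (Q x) α p n y.2) (Q θ s) :=
      (hdi.add (key s).1).congr (.of_forall fun y => by simp [add_comm])
    set R := (expectedAbsCost c (Q θ) (n + 1) s).toReal with hRdef
    have hR0 : 0 ≤ R := ENNReal.toReal_nonneg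
    have hd : ∫ y, |(c s y.1 y.2 + riskToGo c (Q x) α p n y.2) -
        (c s y.1 y.2 + riskToGo c (Q θ) α p n y.2)| ∂(Q θ s) ≤ L * ‖x - θ‖ * R := by
      refine (integral_mono hdi.abs (hR.const_mul _) hbd).trans ?_
      rw [integral_const_mul, hRdef,
        toReal_expectedAbsCost_succ h.measurable_cost (h.finite θ hθ) hn]
      refine mul_le_mul_of_nonneg_left ?_ (by positivity)
      exact le_add_of_nonneg_left (integral_nonneg fun y => abs_nonneg _)
    have hXb := (key s).2
    have hxr : ‖x - θ‖ ≤ r := (mem_ball_iff_norm.1 hx).le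
    simp only [riskToGo]
    rw [← Finset.sum_sub_distrib, Finset.sum_mul, Finset.sum_mul]
    refine (Finset.abs_sum_le_sum_abs _ _).trans (Finset.sum_le_sum fun m _ => ?_)
    rw [← mul_sub, abs_mul, abs_of_pos (hp m), mul_assoc, mul_assoc]
    refine mul_le_mul_of_nonneg_left ?_ (hp m).le
    have hbm := hb m
    have ham := ha m
    refine ((h.tilt x hx s).abs_CVaR_sub_le hXm (key s).1 hXm' hXi' (hα0 m) (hα1 m)).trans ?_
    rw [mul_assoc (1 - α m)⁻¹]
    refine mul_le_mul_of_nonneg_left ?_ hbm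
    set I := ∫ y, |c s y.1 y.2 + riskToGo c (Q θ) α p n y.2| ∂(Q θ s)
    set J := ∫ y, |(c s y.1 y.2 + riskToGo c (Q x) α p n y.2) -
        (c s y.1 y.2 + riskToGo c (Q θ) α p n y.2)| ∂(Q θ s)
    have hJ : J ≤ L * r * R := hd.trans (by gcongr)
    have hJ0 : 0 ≤ J := integral_nonneg fun y => abs_nonneg _
    have hI0 : 0 ≤ I := integral_nonneg fun y => abs_nonneg _
    calc K * ‖x - θ‖ * (I + ((α m)⁻¹ + (1 - α m)⁻¹) * ((1 + K * ‖x - θ‖) * (I + J))) +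
          (1 + K * ‖x - θ‖) * J
        ≤ K * ‖x - θ‖ * ((1 + |B|) * R + ((α m)⁻¹ + (1 - α m)⁻¹) *
            ((1 + K * r) * ((1 + |B|) * R + L * r * R))) +
          (1 + K * r) * (L * ‖x - θ‖ * R) := by gcongr
      _ = _ := by ring

variable [FiniteDimensional ℝ E]

/-- The running costs and one-step laws form a smooth family if the next value function is
differentiable. -/
lemma exists_smoothFamily {n : ℕ} (hn : n + 1 ≤ T)
    (hd : ∀ s, DifferentiableAt ℝ (fun x => riskToGo c (Q x) α p n s) θ) (s : S) :
    ∃ G, SmoothFamily (fun x => Q x s) (fun x y => c s y.1 y.2 + riskToGo c (Q x) α p n y.2)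
      (fun x => ρ x s) (D s)
      (fun y => _root_.gradient (fun x => riskToGo c (Q x) α p n y.2) θ) G K θ := by
  have hθ : θ ∈ Metric.ball θ r := Metric.mem_ball_self h.r_pos
  have hball := Metric.ball_mem_nhds θ h.r_pos
  have hM := h.isMarkovKernel θ hθ
  obtain ⟨L, hL, hLip⟩ := h.abs_riskToGo_sub_le hα0 hα1 hp (Nat.le_of_succ_le hn)
  obtain ⟨hm, B, hB⟩ := measurable_and_abs_riskToGo_le (α := α) (p := p) h.measurable_cost
    (h.finite θ hθ) hα0 hα1 hp (Nat.le_of_succ_le hn)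
  have hmeas : ∀ᶠ x in 𝓝 θ, Measurable (riskToGo c (Q x) α p n) := by
    filter_upwards [hball] with x hx
    have := h.isMarkovKernel x hx
    exact (measurable_and_abs_riskToGo_le h.measurable_cost
      (h.finite x hx) hα0 hα1 hp (Nat.le_of_succ_le hn)).1
  have hgrad : StronglyMeasurable
      (fun s' => _root_.gradient (fun x => riskToGo c (Q x) α p n s') θ) :=
    stronglyMeasurable_of_hasGradientAt hmeas fun s' => (hd s').hasGradientAt
  have hDm : StronglyMeasurable (D s) := stronglyMeasurable_of_hasGradientAt
    (mem_of_superset hball fun x hx => (h.tilt x hx s).measurable) (h.gradient s)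
  -- The Lipschitz constant of the next value function, at the random next state, serves as the
  -- dominating function.
  refine ⟨fun y => L * (expectedAbsCost c (Q θ) n y.2).toReal, ?_, ?_, ?_, ?_, ?_, ?_, ?_, ?_,
    ?_, ?_, h.K_nonneg, fun y => mul_nonneg hL ENNReal.toReal_nonneg⟩
  · filter_upwards [hball] with x hx
    have := h.isMarkovKernel x hx
    infer_instance
  · filter_upwards [hball] with x hx using h.tilt x hx s
  · filter_upwards [hmeas] with x hx
    exact (h.measurable_cost.comp measurable_prodMk_left).add (hx.comp measurable_snd)
  · exact (integral_abs_le_toReal_expectedAbsCost h.measurable_cost (h.finite θ hθ) hn hm hB s).1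
  · exact (integrable_expectedAbsCost h.measurable_cost (h.finite θ hθ) hn s).const_mul L
  · filter_upwards [hball] with x hx y
    rw [add_sub_add_left_eq_sub]
    exact hLip x hx y.2
  · exact h.gradient s
  · intro y
    have := (hd y.2).hasGradientAt.hasFDerivAt.const_add (c s y.1 y.2)
    exact this
  · exact hDm.aestronglyMeasurable
  · exact (hgrad.comp_measurable measurable_snd).aestronglyMeasurable

/-- One step of the policy gradient recursion. -/
lemma hasGradientAt_riskToGo_succ {n : ℕ} (hn : n + 1 ≤ T)
    (hd : ∀ s, DifferentiableAt ℝ (fun x => riskToGo c (Q x) α p n s) θ) (s : S)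
    (hquant : ∀ m x x',
      IsQuantile ((Q θ s).map fun y => c s y.1 y.2 + riskToGo c (Q θ) α p n y.2) (α m) x →
      IsQuantile ((Q θ s).map fun y => c s y.1 y.2 + riskToGo c (Q θ) α p n y.2) (α m) x' → x = x')
    (hsaddle : n ≠ 0 → ∀ m ξ l ξ' l',
      IsSaddlePoint (Q θ s) (fun y => c s y.1 y.2 + riskToGo c (Q θ) α p n y.2) (α m) ξ l →
      IsSaddlePoint (Q θ s) (fun y => c s y.1 y.2 + riskToGo c (Q θ) α p n y.2) (α m) ξ' l' →
      ∀ B : Set S, MeasurableSet B →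
        ∫ y in Prod.snd ⁻¹' B, ξ y ∂(Q θ s) = ∫ y in Prod.snd ⁻¹' B, ξ' y ∂(Q θ s)) :
    (∀ m, ∃ ξ l, IsSaddlePoint (Q θ s)
      (fun y => c s y.1 y.2 + riskToGo c (Q θ) α p n y.2) (α m) ξ l) ∧
    ∀ (ξ : Fin k → A × S → ℝ) (l : Fin k → ℝ),
      (∀ m, IsSaddlePoint (Q θ s) (fun y => c s y.1 y.2 + riskToGo c (Q θ) α p n y.2) (α m)
        (ξ m) (l m)) →
      (∀ m, Integrable (fun y : A × S =>
        max (c s y.1 y.2 + riskToGo c (Q θ) α p n y.2 - l m) 0 • D s y) (Q θ s)) ∧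
      (∀ m, Integrable (fun y : A × S => ξ m y •
        _root_.gradient (fun x => riskToGo c (Q x) α p n y.2) θ) (Q θ s)) ∧
      HasGradientAt (fun x => riskToGo c (Q x) α p (n + 1) s)
        (∑ m, ((p m / (1 - α m)) •
          (∫ y, max (c s y.1 y.2 + riskToGo c (Q θ) α p n y.2 - l m) 0 • D s y ∂(Q θ s)) +
          p m • ∫ y, ξ m y •
            _root_.gradient (fun x => riskToGo c (Q x) α p n y.2) θ ∂(Q θ s))) θ := by
  obtain ⟨G, hF⟩ := h.exists_smoothFamily hα0 hα1 hp hn hd s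
  have hM := h.isMarkovKernel θ (Metric.mem_ball_self h.r_pos)
  have hball := Metric.ball_mem_nhds θ h.r_pos
  refine ⟨fun m => ?_, fun ξ l hs => ⟨fun m => ?_, fun m => ?_, ?_⟩⟩
  · obtain ⟨ξ, hξ⟩ := exists_tailWeight_VaR (ν := Q θ s) hF.measurable_self (hα0 m) (hα1 m)
    exact ⟨ξ, _, hξ.isSaddlePoint hF.integrable⟩
  · exact hF.integrable_smul_density_gradient (integrable_excess hF.integrable (l m))
  · refine hF.integrable_gradient.bdd_smul (1 - α m)⁻¹ (hs m).1.1.aestronglyMeasurable ?_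
    filter_upwards [(hs m).1.2] with y hy
    rw [Real.norm_of_nonneg hy.1]
    exact hy.2
  · have hinv : ∀ m ξ l ξ' l',
        IsSaddlePoint (Q θ s) (fun y => c s y.1 y.2 + riskToGo c (Q θ) α p n y.2) (α m) ξ l →
        IsSaddlePoint (Q θ s) (fun y => c s y.1 y.2 + riskToGo c (Q θ) α p n y.2) (α m) ξ' l' →
        ∫ y, ξ y • _root_.gradient (fun x => riskToGo c (Q x) α p n y.2) θ ∂(Q θ s) =
          ∫ y, ξ' y • _root_.gradient (fun x => riskToGo c (Q x) α p n y.2) θ ∂(Q θ s) := by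
      intro m ξ l ξ' l' h1 h2
      -- With no period left after this one the gradient term is zero, so the last period needs no
      -- condition on saddle-points.
      rcases eq_or_ne n 0 with rfl | hn0
      · have : _root_.gradient (fun _ : E => (0 : ℝ)) θ = 0 := gradient_fun_const θ 0
        simp [riskToGo, this]
      · refine integral_smul_comp_eq_of_setIntegral_eq measurable_snd h1.1.1 h2.1.1
          h1.1.integrable h2.1.integrable (h1.1.2.mono fun y hy => hy.1)
          (h2.1.2.mono fun y hy => hy.1) (hsaddle hn0 m _ _ _ _ h1 h2)
          (g := fun s' => _root_.gradient (fun x => riskToGo c (Q x) α p n s') θ) ?_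
        refine stronglyMeasurable_of_hasGradientAt ?_ fun s' => (hd s').hasGradientAt
        filter_upwards [hball] with x hx
        have := h.isMarkovKernel x hx
        exact (measurable_and_abs_riskToGo_le h.measurable_cost
          (h.finite x hx) hα0 hα1 hp (Nat.le_of_succ_le hn)).1
    have key := fun m => (hF.hasGradientAt_CVaR (hα0 m) (hα1 m) (hquant m) (hinv m)
      (hs m)).hasFDerivAt.const_mul (p m)
    have hsum := HasFDerivAt.fun_sum fun m (_ : m ∈ Finset.univ) => key m
    rw [hasGradientAt_iff_hasFDerivAt]
    refine hsum.congr_fderiv ?_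
    rw [map_sum]
    refine Finset.sum_congr rfl fun m _ => ?_
    rw [← map_smul, smul_add, smul_smul, div_eq_mul_inv]

end SmoothKernelFamily

end KernelFamily

/-! ### Likelihood ratios of policies. -/

section Policy

variable {S A : Type*} {E : Type*} [NormedAddCommGroup E] [InnerProductSpace ℝ E] [CompleteSpace E]

/-- The likelihood ratio of two policies, set to `1` where the reference policy vanishes. -/
def likelihoodRatio (q q' : S → A → ℝ) (s : S) (a : A) : ℝ :=
  open Classical in if q s a = 0 then 1 else q' s a / q s a

lemma likelihoodRatio_of_eq_zero {q q' : S → A → ℝ} {s : S} {a : A} (h : q s a = 0) :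
    likelihoodRatio q q' s a = 1 := if_pos h

lemma likelihoodRatio_of_ne_zero {q q' : S → A → ℝ} {s : S} {a : A} (h : q s a ≠ 0) :
    likelihoodRatio q q' s a = q' s a / q s a := if_neg h

/-- The two-sided Harnack bound puts the ratio in `[exp (-u), exp u]`, and `exp u - 1 ≤ u * exp u`
makes the deviation linear in `u`. -/
lemma abs_likelihoodRatio_sub_one_le {q q' : S → A → ℝ} {s : S} {a : A} {u R : ℝ}
    (h0 : 0 ≤ q s a) (hu : 0 ≤ u) (huR : u ≤ R)
    (h1 : q s a * Real.exp (-u) ≤ q' s a) (h2 : q' s a * Real.exp (-u) ≤ q s a) :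
    |likelihoodRatio q q' s a - 1| ≤ u * Real.exp R := by
  rcases h0.eq_or_lt with h | h
  · rw [likelihoodRatio_of_eq_zero h.symm, sub_self, abs_zero]
    positivity
  · rw [likelihoodRatio_of_ne_zero h.ne']
    have e1 : Real.exp (-u) ≤ q' s a / q s a := by
      rw [le_div_iff₀ h]
      linarith
    have e2 : q' s a / q s a ≤ Real.exp u := by
      rw [div_le_iff₀ h]
      rw [Real.exp_neg, ← div_eq_mul_inv, div_le_iff₀ (Real.exp_pos u)] at h2
      linarith
    have e3 : 1 - u ≤ Real.exp (-u) := by linarith [Real.add_one_le_exp (-u)]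
    have e4 : Real.exp u - 1 ≤ u * Real.exp u := by
      have := mul_le_mul_of_nonneg_right e3 (Real.exp_pos u).le
      rw [← Real.exp_add, neg_add_cancel, Real.exp_zero] at this
      linarith
    have e5 : u * Real.exp u ≤ u * Real.exp R :=
      mul_le_mul_of_nonneg_left (Real.exp_le_exp.2 huR) hu
    have e6 : u ≤ u * Real.exp R := le_mul_of_one_le_right hu (Real.one_le_exp (hu.trans huR))
    exact abs_le.2 ⟨by linarith, by linarith⟩

lemma hasGradientAt_div_self {f : E → ℝ} {θ : E} (hf0 : f θ ≠ 0) (hpos : ∀ᶠ x in 𝓝 θ, 0 < f x)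
    (hd : DifferentiableAt ℝ (fun x => Real.log (f x)) θ) :
    HasGradientAt (fun x => f x / f θ) (gradient (fun x => Real.log (f x)) θ) θ := by
  have h1 := hd.hasGradientAt.hasFDerivAt.exp.mul_const (f θ)⁻¹
  rw [Real.exp_log hpos.self_of_nhds, smul_smul, inv_mul_cancel₀ hf0, one_smul] at h1
  rw [hasGradientAt_iff_hasFDerivAt]
  refine h1.congr_of_eventuallyEq ?_
  filter_upwards [hpos] with x hx
  rw [Real.exp_log hx, div_eq_mul_inv]

variable [MeasurableSpace S] [MeasurableSpace A]

lemma measurable_likelihoodRatio {q q' : S → A → ℝ} (hq : Measurable fun z : S × A => q z.1 z.2)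
    (hq' : Measurable fun z : S × A => q' z.1 z.2) (s : S) :
    Measurable (likelihoodRatio q q' s) := by
  have h1 : Measurable (q s) := hq.comp measurable_prodMk_left
  have h2 : Measurable (q' s) := hq'.comp measurable_prodMk_left
  exact Measurable.ite (h1 (measurableSet_singleton 0)) measurable_const (h2.div h1)

lemma smoothKernelFamily_stepLaw {μ : Measure A} [SFinite μ] {P : Kernel (S × A) S}
    [IsMarkovKernel P] {c : S → A → S → ℝ}
    (hc : Measurable (fun z : S × A × S => c z.1 z.2.1 z.2.2)) {T : ℕ}
    {Θ : Set E} (hΘ : IsOpen Θ) {π : E → S → A → ℝ}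
    (hπ0 : ∀ θ ∈ Θ, ∀ s a, 0 ≤ π θ s a)
    (hπm : ∀ θ ∈ Θ, Measurable (fun z : S × A => π θ z.1 z.2))
    (hπ1 : ∀ θ ∈ Θ, ∀ s, ∫⁻ a, ENNReal.ofReal (π θ s a) ∂μ = 1)
    (hπc : ∀ s a, ContinuousOn (fun θ => π θ s a) Θ)
    (hdiff : ∀ θ ∈ Θ, ∀ s a, π θ s a ≠ 0 →
      DifferentiableAt ℝ (fun θ' => Real.log (π θ' s a)) θ)
    {C : ℝ} (hbound : ∀ θ ∈ Θ, ∀ s a, π θ s a ≠ 0 →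
      ‖gradient (fun θ' => Real.log (π θ' s a)) θ‖ ≤ C)
    (hint : ∀ θ ∈ Θ, ∀ s, expectedAbsCost c (stepLaw μ P (π θ)) T s < ⊤)
    {θ : E} (hθ : θ ∈ Θ) :
    ∃ K r, SmoothKernelFamily c (fun x => stepLaw μ P (π x)) T
      (fun x s y => likelihoodRatio (π θ) (π x) s y.1)
      (fun s y => gradient (fun θ' => Real.log (π θ' s y.1)) θ) K r θ := by
  obtain ⟨r, hr, hball⟩ := Metric.isOpen_iff.1 hΘ θ hθ
  -- `|C|` is used because `C` is not assumed nonnegative.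
  have hharnack : ∀ x ∈ Metric.ball θ r, ∀ y ∈ Metric.ball θ r, ∀ s a,
      π x s a * Real.exp (-(|C| * ‖y - x‖)) ≤ π y s a := fun x hx y hy s a =>
    mul_exp_neg_le_of_norm_gradient_log_le hΘ (fun z hz => hπ0 z hz s a) (hπc s a)
      (fun z hz => hdiff z hz s a) (fun z hz hne => (hbound z hz s a hne).trans (le_abs_self C))
      (((convex_ball θ r).segment_subset hx hy).trans hball)
  have hself : θ ∈ Metric.ball θ r := Metric.mem_ball_self hr
  -- Harnack in the direction from `x` to `θ`: a policy vanishing at `θ` vanishes on the whole ball,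
  -- so the laws at `x` are absolutely continuous with respect to the law at `θ`.
  have hzero : ∀ x ∈ Metric.ball θ r, ∀ s a, π θ s a = 0 → π x s a = 0 := fun x hx s a h => by
    have := hharnack x hx θ hself s a
    rw [h] at this
    exact le_antisymm (nonpos_of_mul_nonpos_left this (Real.exp_pos _)) (hπ0 x (hball hx) s a)
  refine ⟨|C| * Real.exp (|C| * r), r, hc, hr, by positivity, fun x hx =>
    isMarkovKernel_stepLaw (hπm x (hball hx)) (hπ1 x (hball hx)), fun x hx => hint x (hball hx),
    fun x hx s => ?_, fun s y => ?_⟩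
  · have hρm := measurable_likelihoodRatio (hπm θ hθ) (hπm x (hball hx)) s
    have hρ0 : ∀ a, 0 ≤ likelihoodRatio (π θ) (π x) s a := fun a => by
      by_cases h : π θ s a = 0
      · rw [likelihoodRatio_of_eq_zero h]
        exact zero_le_one
      · rw [likelihoodRatio_of_ne_zero h]
        exact div_nonneg (hπ0 x (hball hx) s a) (hπ0 θ hθ s a)
    refine ⟨hρm.comp measurable_fst, fun y => hρ0 y.1, fun y => ?_,
      stepLaw_eq_withDensity (hπm θ hθ) (hπm x (hball hx)) s hρm hρ0 fun a => ?_⟩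
    · have h2 := hharnack x hx θ hself s y.1
      rw [norm_sub_rev] at h2
      refine (abs_likelihoodRatio_sub_one_le (hπ0 θ hθ s y.1)
        (mul_nonneg (abs_nonneg C) (norm_nonneg (x - θ)))
        (mul_le_mul_of_nonneg_left (mem_ball_iff_norm.1 hx).le (abs_nonneg C))
        (hharnack θ hself x hx s y.1) h2).trans (le_of_eq ?_)
      ring
    · by_cases h : π θ s a = 0
      · rw [h, hzero x hx s a h, mul_zero]
      · rw [likelihoodRatio_of_ne_zero h, div_mul_cancel₀ _ h]
  · by_cases h : π θ s y.1 = 0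
    · have e : (fun θ' => Real.log (π θ' s y.1)) =ᶠ[𝓝 θ] fun _ => 0 := by
        filter_upwards [Metric.ball_mem_nhds θ hr] with x hx
        rw [hzero x hx s y.1 h, Real.log_zero]
      rw [e.gradient_eq, gradient_fun_const]
      simp only [likelihoodRatio_of_eq_zero h]
      exact hasGradientAt_const θ 1
    · simp only [likelihoodRatio_of_ne_zero h]
      have hpos : ∀ᶠ x in 𝓝 θ, 0 < π x s y.1 :=
        ((hπc s y.1).continuousAt (hΘ.mem_nhds hθ)).eventually
          (lt_mem_nhds ((hπ0 θ hθ s y.1).lt_of_ne' h))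
      exact hasGradientAt_div_self (f := fun x => π x s y.1) h hpos (hdiff θ hθ s y.1 h)

end Policy

end

/-! ### The policy gradient formula. -/

theorem mainTheorem4
    {S A : Type*} [MeasurableSpace S] [MeasurableSpace A] {d k : ℕ}
    -- the environment: reference measure on actions, transition kernel, cost function
    (μ : Measure A) [SFinite μ]
    (P : Kernel (S × A) S) [IsMarkovKernel P]
    (c : S → A → S → ℝ) (hc : Measurable (fun z : S × A × S => c z.1 z.2.1 z.2.2))
    -- the spectrum `∑ m, p m δ_{α m}`
    (α p : Fin k → ℝ) (hα : StrictMono α) (hα0 : ∀ m, 0 < α m) (hα1 : ∀ m, α m < 1)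
    (hp : ∀ m, 0 < p m) (hp1 : ∑ m, p m = 1)
    (T : ℕ)
    -- the parametrised policies `π θ s a = π^θ(a | s)`, densities with respect to `μ`
    (Θ : Set (EuclideanSpace ℝ (Fin d))) (hΘ : IsOpen Θ)
    (π : EuclideanSpace ℝ (Fin d) → S → A → ℝ)
    (hπ0 : ∀ θ ∈ Θ, ∀ s a, 0 ≤ π θ s a)
    (hπm : ∀ θ ∈ Θ, Measurable (fun z : S × A => π θ z.1 z.2))
    (hπ1 : ∀ θ ∈ Θ, ∀ s, ∫⁻ a, ENNReal.ofReal (π θ s a) ∂μ = 1)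
    (hπc : ∀ s a, ContinuousOn (fun θ => π θ s a) Θ)
    -- the log-likelihood is differentiable where the likelihood is nonzero, with bounded gradient
    (hdiff : ∀ θ ∈ Θ, ∀ s a, π θ s a ≠ 0 →
      DifferentiableAt ℝ (fun θ' => Real.log (π θ' s a)) θ)
    (C : ℝ)
    (hbound : ∀ θ ∈ Θ, ∀ s a, π θ s a ≠ 0 →
      ‖gradient (fun θ' => Real.log (π θ' s a)) θ‖ ≤ C)
    -- the costs are integrable
    (hint : ∀ θ ∈ Θ, ∀ s, expectedAbsCost c (stepLaw μ P (π θ)) T s < ⊤)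
    -- the parameter at which the gradient is taken
    (θ : EuclideanSpace ℝ (Fin d)) (hθ : θ ∈ Θ)
    -- the running risk-to-go has unique quantiles
    (hquant : ∀ t < T, ∀ s m x x',
      IsQuantile ((stepLaw μ P (π θ) s).map
        (runningCost c (stepLaw μ P (π θ)) α p T t s)) (α m) x →
      IsQuantile ((stepLaw μ P (π θ) s).map
        (runningCost c (stepLaw μ P (π θ)) α p T t s)) (α m) x' → x = x')
    -- before the last period, all saddle-points reweight the law of the next state alike
    (hsaddle : ∀ t, t + 1 < T → ∀ s m ξ l ξ' l',
      IsSaddlePoint (stepLaw μ P (π θ) s)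
        (runningCost c (stepLaw μ P (π θ)) α p T t s) (α m) ξ l →
      IsSaddlePoint (stepLaw μ P (π θ) s)
        (runningCost c (stepLaw μ P (π θ)) α p T t s) (α m) ξ' l' →
      ∀ B : Set S, MeasurableSet B →
        ∫ y in Prod.snd ⁻¹' B, ξ y ∂(stepLaw μ P (π θ) s) =
          ∫ y in Prod.snd ⁻¹' B, ξ' y ∂(stepLaw μ P (π θ) s)) :
    -- the last period
    (∀ t, t + 1 = T → ∀ s : S,
      (∀ m, ∃ ξ l, IsSaddlePoint (stepLaw μ P (π θ) s)
        (fun y => c s y.1 y.2) (α m) ξ l) ∧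
      ∀ (ξ : Fin k → A × S → ℝ) (l : Fin k → ℝ),
        (∀ m, IsSaddlePoint (stepLaw μ P (π θ) s)
          (fun y => c s y.1 y.2) (α m) (ξ m) (l m)) →
        (∀ m, Integrable (fun y : A × S => max (c s y.1 y.2 - l m) 0 •
            gradient (fun θ' => Real.log (π θ' s y.1)) θ) (stepLaw μ P (π θ) s)) ∧
        HasGradientAt (fun θ' => valueFn c (stepLaw μ P (π θ')) α p T t s)
          (∑ m, (p m / (1 - α m)) •
            ∫ y, max (c s y.1 y.2 - l m) 0 •
              gradient (fun θ' => Real.log (π θ' s y.1)) θ ∂(stepLaw μ P (π θ) s)) θ) ∧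
    -- the earlier periods
    (∀ t, t + 1 < T → ∀ s : S,
      (∀ m, ∃ ξ l, IsSaddlePoint (stepLaw μ P (π θ) s)
        (runningCost c (stepLaw μ P (π θ)) α p T t s) (α m) ξ l) ∧
      ∀ (ξ : Fin k → A × S → ℝ) (l : Fin k → ℝ),
        (∀ m, IsSaddlePoint (stepLaw μ P (π θ) s)
          (runningCost c (stepLaw μ P (π θ)) α p T t s) (α m) (ξ m) (l m)) →
        (∀ m, Integrable (fun y : A × S =>
            max (c s y.1 y.2 + valueFn c (stepLaw μ P (π θ)) α p T (t + 1) y.2 - l m) 0 •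
              gradient (fun θ' => Real.log (π θ' s y.1)) θ) (stepLaw μ P (π θ) s)) ∧
        (∀ m, Integrable (fun y : A × S => ξ m y •
            gradient (fun θ' => valueFn c (stepLaw μ P (π θ')) α p T (t + 1) y.2) θ)
          (stepLaw μ P (π θ) s)) ∧
        HasGradientAt (fun θ' => valueFn c (stepLaw μ P (π θ')) α p T t s)
          (∑ m, ((p m / (1 - α m)) •
              (∫ y, max (c s y.1 y.2 + valueFn c (stepLaw μ P (π θ)) α p T (t + 1) y.2 - l m) 0 •
                gradient (fun θ' => Real.log (π θ' s y.1)) θ ∂(stepLaw μ P (π θ) s)) +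
            p m • ∫ y, ξ m y •
              gradient (fun θ' => valueFn c (stepLaw μ P (π θ')) α p T (t + 1) y.2) θ
                ∂(stepLaw μ P (π θ) s))) θ) := by
  obtain ⟨K, r, hF⟩ := smoothKernelFamily_stepLaw hc hΘ hπ0 hπm hπ1 hπc hdiff hbound hint hθ
  -- The recursion runs on the number `n` of periods left after the current one, i.e. `t = T - (n +
  -- 1)`; `n ≠ 0` is exactly `t + 1 < T`.
  have step : ∀ n, n + 1 ≤ T → (∀ s, DifferentiableAt ℝ
      (fun x => riskToGo c (stepLaw μ P (π x)) α p n s) θ) → ∀ s, _ := fun n hn hd s =>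
    hF.hasGradientAt_riskToGo_succ hα0 hα1 hp hn hd s
      (by
        have := hquant (T - (n + 1)) (by omega) s
        unfold runningCost valueFn at this
        rwa [show T - (T - (n + 1) + 1) = n by omega] at this)
      (fun hn0 => by
        have := hsaddle (T - (n + 1)) (by omega) s
        unfold runningCost valueFn at this
        rwa [show T - (T - (n + 1) + 1) = n by omega] at this)
  have hd : ∀ n ≤ T, ∀ s, DifferentiableAt ℝ
      (fun x => riskToGo c (stepLaw μ P (π x)) α p n s) θ := by
    intro n
    induction n with
    | zero => exact fun _ s => differentiableAt_const 0
    | succ n ih =>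
      intro hn s
      obtain ⟨h1, h2⟩ := step n hn (ih (Nat.le_of_succ_le hn)) s
      -- Differentiability asks for no particular saddle-point, so any existing choice feeds the
      -- induction.
      choose ξ l hs using h1
      exact (h2 ξ l hs).2.2.differentiableAt
  refine ⟨fun t ht s => ?_, fun t ht s => ?_⟩
  · have h0 := step 0 (by omega) (hd 0 (Nat.zero_le T)) s
    have hT : T - t = 0 + 1 := by omega
    have hgrad : gradient (fun _ : EuclideanSpace ℝ (Fin d) => (0 : ℝ)) θ = 0 :=
      gradient_fun_const θ 0
    unfold valueFn
    rw [hT]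
    simp only [show ∀ x s', riskToGo c (stepLaw μ P (π x)) α p 0 s' = 0 from fun _ _ => rfl, hgrad,
      smul_zero, integral_zero, add_zero] at h0
    exact ⟨h0.1, fun ξ l hs => ⟨(h0.2 ξ l hs).1, (h0.2 ξ l hs).2.2⟩⟩
  · have h0 := step (T - (t + 1)) (by omega) (hd _ (Nat.sub_le T (t + 1))) s
    have hT : T - t = T - (t + 1) + 1 := by omega
    unfold runningCost valueFn
    rw [hT]
    exact h0
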